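/- Let $\mathbf k$ be a field of characteristic zero and let $W=W_0\oplus W_1$ be a finite-dimensional $\mathbb Z_2$-graded vector space over $\mathbf k$. Let $d$ be an $L_\infty$ structure on $W$, i.e. an odd codifferential on the symmetric coalgebra $\bigodot W$, given by its components: odd graded symmetric multilinear maps $d_r:W^r\to W$ ($r\ge 1$) such that, for all $n\ge1$ and all homogeneous $w_1,\dots,w_n$, $$\sum_{k+l=n+1}\ \sum_{\sigma\in \mathrm{Sh}(k,n-k)}\epsilon(\sigma)\,d_l\bigl(d_k(w_{\sigma(1)},\dots,w_{\sigma(k)}),w_{\sigma(k+1)},\dots,w_{\sigma(n)}\bigr)=0,$$ where $\mathrm{Sh}(k,n-k)$ is the set of unshuffles and $w_1\odot\cdots\odot w_n=\epsilon(\sigma)\,w_{\sigma(1)}\odot\cdots\odot w_{\sigma(n)}$. Assume $d_1=0$. Let $\langle\cdot,\cdot\rangle$ be a non-degenerate even bilinear form on $W$ which is graded antisymmetric, $\langle w_2,w_1\rangle=-(-1)^{w_1w_2}\langle w_1,w_2\rangle$, and invariant: $\langle d_r(w_1,\dots,w_r),w_{r+1}\rangle=-(-1)^{w_1}\langle w_1,d_r(w_2,\dots,w_{r+1})\rangle$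 for all $r$ and all homogeneous $w_i$. Let $(e_i)$ be a homogeneous basis of $W$, let $d_{j_1,\dots,j_s}=\langle d_{s-1}(e_{j_1},\dots,e_{j_{s-1}}),e_{j_s}\rangle$ for $s\ge2$, and let $(k^{ab})$ be the inverse of the matrix $(\langle e_a,e_b\rangle)$. *Graphs.* A graph here is a finite graph, with loops and multiple edges allowed, all of whose vertices have valence at least $3$. An orientation of a graph is an ordering of its vertices together with an arrow on each edge, up to the following rule: a permutation $\pi$ of the order of the vertices together with the reversal of $q$ arrows changes the orientation by the sign $\operatorname{sgn}(\pi)(-1)^q$. The graph complex (the cellular complex of metric ordinary graphs) is the $\mathbf k$-vector space generated by isomorphism classes of oriented graphs, with a graph equal to minus the same graph with the opposite orientation; it is bigraded by the numbers of vertices and of edges. The boundary $\partial\Gamma$ of an oriented graph is the sum of the contractions $\Gamma/e$ over all edges $e$ which are not loops, oriented as follows: represent the orientation of $\Gamma$ so that the arrow on $e$ points to the last vertex; this vertex is merged into the tail of the arrow, and the order of the other vertices and the other arrows are kept. *The number $Z(\Gamma)$.* For an oriented graph $\Gamma$, choose an order of the half-edges at each vertex. Label the half-edges by basis indices $j$,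 associate $d_{j_1,\dots,j_s}$ to a vertex whose half-edges are labeled $j_1,\dots,j_s$ in the chosen order, and $k^{ab}$ to an edge whose tail is labeled $a$ and whose head is labeled $b$. Then $Z(\Gamma)$ is the graded contraction of the vertex tensors, in the order of the vertices, with the edge tensors: the sum over all labelings of the products of these numbers, each multiplied by the Koszul sign of the permutation taking the half-edges from their order in the product of the vertex tensors (vertex by vertex) to their order in the product of the edge tensors (edge by edge, tail before head), a half-edge being odd if the basis vector labeling it is odd. *Claim.* 1. $Z(\Gamma)$ depends neither on the order chosen at the vertices nor on any ordering of the edges; it is invariant under isomorphisms of oriented graphs and changes its sign when the orientation is reversed. 2. Consequently, in each bidegree, the chain $$Z=\sum_{\Gamma}\frac{Z(\Gamma)}{|\mathrm{Aut}\,\Gamma|}\,\Gamma ,$$ where $\Gamma$ runs over the isomorphism classes of graphs, each with an arbitrary orientation, and $\mathrm{Aut}\,\Gamma$ is the group of automorphisms of the graph (as permutations of its vertices and half-edges, orientations disregarded), is well defined, i.e. independent of all choices of representatives, orientations and orders; the same is true of the sum over the classes with any given property of graphs. 3. $Z$ is a cycle: $\partial Z=0$ in each bidegree. Likewise, the sum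 over the connected graphs only is a cycle. -/

import Mathlib

open Finset

noncomputable section

namespace GraphCycle

/-! ### Signs -/

/-- The Koszul sign of a change of order: the product of `-1` over all pairs of odd objects which
stand in one order with respect to `r` and in the opposite order with respect to `s`. -/
def koszulSign {α : Type*} [Fintype α] (r s : α → α → Prop) (odd : α → Prop) : ℤˣ :=
  open Classical in
  ∏ x : α, ∏ y : α, if r x y ∧ s y x ∧ odd x ∧ odd y then -1 else 1

/-- The sign `ε(σ)` defined by `w₁ ⊙ ⋯ ⊙ wₙ = ε(σ) w_σ(1) ⊙ ⋯ ⊙ w_σ(n)` in the graded symmetric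
algebra, where `wᵢ` is homogeneous of parity `p i`. -/
def permSign {n : ℕ} (σ : Equiv.Perm (Fin n)) (p : Fin n → ZMod 2) : ℤˣ :=
  koszulSign (fun i j => i < j) (fun i j => σ i < σ j) (fun i => p (σ i) = 1)

/-- `(-1)^p` for a parity `p`. -/
def paritySign (p : ZMod 2) : ℤˣ := if p = 1 then -1 else 1

/-! ### L-infinity algebras with an invariant inner product -/

/-- The unshuffles of type `(a, n - a)`: the permutations of `n` letters that are increasing on
the first `a` letters and on the last `n - a` letters. -/
def unshuffles (a n : ℕ) : Finset (Equiv.Perm (Fin n)) :=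
  open Classical in
  univ.filter fun σ =>
    (∀ i j : Fin n, i < j → j.val < a → σ i < σ j) ∧ (∀ i j : Fin n, i < j → a ≤ i.val → σ i < σ j)

/-- The left-hand side of the L-infinity relation with `N + 1` arguments, of parities `p`:
the sum, over `k + l = N` and over the unshuffles `σ` of type `(k + 1, l)`, of
`ε(σ) d_{l+1}(d_{k+1}(w_σ(1), …, w_σ(k+1)), w_σ(k+2), …, w_σ(N+1))`.
Here `d r` is the operation with `r + 1` arguments. -/
def linfinityRelator {k W : Type*} [Field k] [AddCommGroup W] [Module k W]
    (d : (r : ℕ) → MultilinearMap k (fun _ : Fin (r + 1) => W) W)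
    (N : ℕ) (p : Fin (N + 1) → ZMod 2) (w : Fin (N + 1) → W) : W :=
  ∑ a : Fin (N + 1), ∑ σ ∈ unshuffles (a.val + 1) (N + 1),
    permSign σ p •
      d (N - a.val)
        (Fin.cons
          (d a.val fun i : Fin (a.val + 1) => w (σ ⟨i.val, by omega⟩))
          (fun i : Fin (N - a.val) => w (σ ⟨a.val + 1 + i.val, by omega⟩)))

/-- An L-infinity structure on the `ℤ/2`-graded vector space `W = 𝒲 0 ⊕ 𝒲 1`, in the form of an
odd codifferential on the symmetric coalgebra of `W`, given by its components: odd graded symmetric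
maps `d_{r+1} : W^{r+1} → W`, `r ≥ 0`, satisfying the L-infinity relations, which say that the
coderivation with these components has square zero. The map with `r + 1` arguments is `d r`. -/
structure LInfinityAlgebra (k : Type*) {W : Type*} [Field k] [AddCommGroup W] [Module k W]
    (𝒲 : ZMod 2 → Submodule k W) where
  d : (r : ℕ) → MultilinearMap k (fun _ : Fin (r + 1) => W) W
  odd : ∀ (r : ℕ) (p : Fin (r + 1) → ZMod 2) (w : Fin (r + 1) → W), (∀ i, w i ∈ 𝒲 (p i)) →
    d r w ∈ 𝒲 (∑ i, p i + 1)
  symmetric : ∀ (r : ℕ) (σ : Equiv.Perm (Fin (r + 1))) (p : Fin (r + 1) → ZMod 2)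
    (w : Fin (r + 1) → W), (∀ i, w i ∈ 𝒲 (p i)) →
    d r w = permSign σ p • d r (fun i => w (σ i))
  relation : ∀ (N : ℕ) (p : Fin (N + 1) → ZMod 2) (w : Fin (N + 1) → W), (∀ i, w i ∈ 𝒲 (p i)) →
    linfinityRelator d N p w = 0

/-- `B` is an even, graded antisymmetric inner product that is invariant with respect to the
L-infinity structure:
`⟨d(w₁, …, wₙ), wₙ₊₁⟩ = (-1)^(w₁ + 1) ⟨w₁, d(w₂, …, wₙ₊₁)⟩` for homogeneous `wᵢ`. -/
structure IsInvariantInnerProduct {k W : Type*} [Field k] [AddCommGroup W] [Module k W]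
    {𝒲 : ZMod 2 → Submodule k W} (L : LInfinityAlgebra k 𝒲) (B : LinearMap.BilinForm k W) :
    Prop where
  nondegenerate : B.Nondegenerate
  even : ∀ (p q : ZMod 2) (x y : W), x ∈ 𝒲 p → y ∈ 𝒲 q → p ≠ q → B x y = 0
  antisymmetric : ∀ (p q : ZMod 2) (x y : W), x ∈ 𝒲 p → y ∈ 𝒲 q →
    B y x = -(paritySign (p * q) • B x y)
  invariant : ∀ (r : ℕ) (p : Fin (r + 2) → ZMod 2) (w : Fin (r + 2) → W), (∀ i, w i ∈ 𝒲 (p i)) →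
    B (L.d r fun i => w i.castSucc) (w (Fin.last (r + 1))) =
      -(paritySign (p 0) • B (w 0) (L.d r fun i => w i.succ))

/-! ### Oriented graphs -/

/-- The number of half-edges at the vertex `v`. The half-edges are the pairs `(e, x)`, where
`(e, false)` is the tail and `(e, true)` is the head of the arrow on the edge `e`, and `Γ` sends
each half-edge to its vertex. -/
def valence {n m : ℕ} (Γ : Fin m × Bool → Fin n) (v : Fin n) : ℕ :=
  Fintype.card {h : Fin m × Bool // Γ h = v}

/-- An oriented graph with `n` vertices and `m` edges, all of whose vertices are at least
trivalent: its vertices are ordered (they are `0, …, n - 1`) and each of its edges (named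
`0, …, m - 1`) carries an arrow, from `Γ (e, false)` to `Γ (e, true)`.
Loops and multiple edges are allowed. -/
abbrev OrientedGraph (n m : ℕ) : Type :=
  {Γ : Fin m × Bool → Fin n // ∀ v, 3 ≤ valence Γ v}

/-- A change of the vertex order, of the names of the edges, and of the arrows:
a permutation of the vertices, a permutation of the edges, and the set of the edges whose arrow is
reversed. -/
abbrev Relabeling (n m : ℕ) : Type :=
  Equiv.Perm (Fin n) × Equiv.Perm (Fin m) × (Fin m → Bool)

/-- The permutation `(e, x) ↦ (π e, x)`, or `(π e, !x)` if the arrow on `e` is reversed. -/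
def halfEdgePerm {m : ℕ} (π : Equiv.Perm (Fin m)) (ρ : Fin m → Bool) :
    Equiv.Perm (Fin m × Bool) :=
  Equiv.prodShear π fun e => if ρ e then Equiv.boolNot else Equiv.refl Bool

/-- The relabeled graph. -/
def relabel {n m : ℕ} (g : Relabeling n m) (Γ : OrientedGraph n m) : OrientedGraph n m :=
  ⟨fun h => g.1 (Γ.1 ((halfEdgePerm g.2.1 g.2.2).symm h)), fun v => by
    have h := Γ.2 (g.1.symm v)
    refine h.trans (le_of_eq ?_)
    refine Fintype.card_congr ((halfEdgePerm g.2.1 g.2.2).subtypeEquiv fun x => ?_)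
    simp [Equiv.eq_symm_apply]⟩

/-- The effect of a relabeling on the orientation: the sign of the permutation of the vertices times
`-1` for each reversed arrow. -/
def orientationSign {n m : ℕ} (g : Relabeling n m) : ℤˣ :=
  Equiv.Perm.sign g.1 * ∏ e, if g.2.2 e then -1 else 1

/-- Two oriented graphs are isomorphic as graphs (without regard to orientation). -/
def Isomorphic {n m : ℕ} (Γ Γ' : OrientedGraph n m) : Prop :=
  ∃ g : Relabeling n m, relabel g Γ = Γ'

/-- The number of automorphisms of the underlying graph, as permutations of its vertices and
half-edges. -/
def autCount {n m : ℕ} (Γ : OrientedGraph n m) : ℕ :=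
  Nat.card {g : Relabeling n m // relabel g Γ = Γ}

def IsConnected {n m : ℕ} (Γ : OrientedGraph n m) : Prop :=
  (SimpleGraph.fromRel fun u v => ∃ e, Γ.1 (e, false) = u ∧ Γ.1 (e, true) = v).Connected

/-- `R` consists of exactly one oriented graph from each isomorphism class of the graphs with the
property `P`. -/
def IsRepresentatives {n m : ℕ} (P : OrientedGraph n m → Prop) (R : Finset (OrientedGraph n m)) :
    Prop :=
  (∀ Γ ∈ R, P Γ) ∧ ∀ Γ, P Γ → ∃! Γ', Γ' ∈ R ∧ Isomorphic Γ Γ'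

/-! ### The graph complex -/

/-- The relations of the graph complex: isomorphic oriented graphs are equal if the orientations
agree, and opposite if the orientations are opposite. -/
def relations (k : Type*) [Field k] (n m : ℕ) : Submodule k (OrientedGraph n m →₀ k) :=
  Submodule.span k (Set.range fun x : Relabeling n m × OrientedGraph n m =>
    Finsupp.single (relabel x.1 x.2) 1 - orientationSign x.1 • Finsupp.single x.2 1)

/-- The part of the complex of ordinary graphs generated by the oriented graphs with `n` vertices
and `m` edges. -/
abbrev Chains (k : Type*) [Field k] (n m : ℕ) : Type _ :=
  (OrientedGraph n m →₀ k) ⧸ relations k n m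

/-- The generator of the complex given by an oriented graph. -/
def graphClass (k : Type*) [Field k] {n m : ℕ} (Γ : OrientedGraph n m) : Chains k n m :=
  (relations k n m).mkQ (Finsupp.single Γ 1)

/-- The vertices after `w` has been merged into `u`: the vertices other than `w` keep their order,
and `w` goes where `u` goes. -/
def mergeMap {n : ℕ} (u w : Fin (n + 1)) (h : u ≠ w) (x : Fin (n + 1)) : Fin n :=
  (finSuccAboveEquiv w).symm ⟨if x = w then u else x, by split_ifs <;> assumption⟩

theorem succAbove_mergeMap {n : ℕ} (u w : Fin (n + 1)) (h : u ≠ w) (x : Fin (n + 1)) :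
    w.succAbove (mergeMap u w h x) = if x = w then u else x := by
  have := (finSuccAboveEquiv w).apply_symm_apply ⟨if x = w then u else x, by split_ifs <;> assumption⟩
  exact congrArg Subtype.val this

theorem three_le_valence_merge {n m : ℕ} (Γ : OrientedGraph (n + 1) (m + 1)) (e : Fin (m + 1))
    (h : Γ.1 (e, false) ≠ Γ.1 (e, true)) (v : Fin n) :
    3 ≤ valence (fun x : Fin m × Bool =>
      mergeMap (Γ.1 (e, false)) (Γ.1 (e, true)) h (Γ.1 (e.succAbove x.1, x.2))) v := by
  classical
  obtain ⟨Γ, hΓ⟩ := Γ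
  simp only at h ⊢
  set u := Γ (e, false) with hu
  set w := Γ (e, true) with hw
  set y := w.succAbove v with hy
  have hyw : y ≠ w := Fin.succAbove_ne w v
  have hm : ∀ x, mergeMap u w h x = v ↔ (if x = w then u else x) = y := fun x => by
    rw [← succAbove_mergeMap u w h x, hy, Fin.succAbove_right_inj]
  -- the half-edges of the contracted graph are those of `Γ` outside `e`
  have key : valence (fun x : Fin m × Bool => mergeMap u w h (Γ (e.succAbove x.1, x.2))) v =
      #{g : Fin (m + 1) × Bool | g.1 ≠ e ∧ (if Γ g = w then u else Γ g) = y} := by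
    rw [valence, Fintype.card_subtype]
    refine Finset.card_bij (fun x _ => (e.succAbove x.1, x.2)) ?_ ?_ ?_
    · intro x hx
      simp only [mem_filter, mem_univ, true_and, hm] at hx ⊢
      exact ⟨Fin.succAbove_ne e _, hx⟩
    · intro x _ x' _ hxx
      simp only [Prod.mk.injEq, Fin.succAbove_right_inj] at hxx
      exact Prod.ext hxx.1 hxx.2
    · rintro ⟨a, c⟩ hg
      simp only [mem_filter, mem_univ, true_and] at hg
      obtain ⟨a', rfl⟩ := Fin.exists_succAbove_eq hg.1
      exact ⟨(a', c), by simpa [hm] using hg.2, rfl⟩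
  have hval : ∀ z, valence Γ z = #{g : Fin (m + 1) × Bool | Γ g = z} := fun z => by
    rw [valence, Fintype.card_subtype]
  rw [key]
  by_cases hyu : y = u
  · have h1 := hΓ u
    have h2 := hΓ w
    rw [hval] at h1 h2
    have hdisj : Disjoint ({g : Fin (m + 1) × Bool | Γ g = u} : Finset _)
        ({g : Fin (m + 1) × Bool | Γ g = w} : Finset _) := by
      rw [Finset.disjoint_filter]
      intro g _ hg hg'
      exact h (hg.symm.trans hg')
    have hsub : ({g : Fin (m + 1) × Bool | Γ g = u} : Finset _) ∪
        ({g : Fin (m + 1) × Bool | Γ g = w} : Finset _) ⊆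
        ({g : Fin (m + 1) × Bool | g.1 ≠ e ∧ (if Γ g = w then u else Γ g) = y} : Finset _) ∪
          {(e, false), (e, true)} := by
      rintro ⟨a, c⟩ hg
      simp only [mem_union, mem_filter, mem_univ, true_and, mem_insert, mem_singleton] at hg ⊢
      by_cases hae : a = e
      · right; subst hae; cases c <;> simp
      · left
        refine ⟨hae, ?_⟩
        rw [hyu]
        split_ifs with hc
        · rfl
        · exact hg.resolve_right hc
    have h3 := Finset.card_le_card hsub
    rw [Finset.card_union_of_disjoint hdisj] at h3
    have h4 := Finset.card_union_le
      ({g : Fin (m + 1) × Bool | g.1 ≠ e ∧ (if Γ g = w then u else Γ g) = y} : Finset _)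
      {(e, false), (e, true)}
    have h5 : #({(e, false), (e, true)} : Finset (Fin (m + 1) × Bool)) ≤ 2 := Finset.card_le_two
    omega
  · have h1 := hΓ y
    rw [hval] at h1
    refine h1.trans (Finset.card_le_card ?_)
    rintro ⟨a, c⟩ hg
    simp only [mem_filter, mem_univ, true_and] at hg ⊢
    refine ⟨?_, ?_⟩
    · rintro rfl
      cases c
      · exact hyu hg.symm
      · exact hyw hg.symm
    · rw [if_neg (hg ▸ hyw), hg]

/-- The graph obtained by contracting the edge `e`, whose end points are distinct: the head of the
arrow on `e` is merged into its tail. -/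
def contract {n m : ℕ} (Γ : OrientedGraph (n + 1) (m + 1)) (e : Fin (m + 1))
    (h : Γ.1 (e, false) ≠ Γ.1 (e, true)) : OrientedGraph n m :=
  ⟨fun x => mergeMap (Γ.1 (e, false)) (Γ.1 (e, true)) h (Γ.1 (e.succAbove x.1, x.2)),
    three_le_valence_merge Γ e h⟩

/-- The contribution of the edge `e` to the boundary of an oriented graph. If the arrow on `e`
points to the last vertex `n`, then this vertex is merged into the tail of the arrow, and the
other vertices keep their order. In general the head `w` of the arrow is first moved to the last
place, which changes the orientation by `(-1)^(n - w)`. An edge that is a loop is not contracted. -/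
def boundaryTerm (k : Type*) [Field k] {n m : ℕ} (Γ : OrientedGraph (n + 1) (m + 1))
    (e : Fin (m + 1)) : Chains k n m :=
  if h : Γ.1 (e, false) ≠ Γ.1 (e, true) then
    ((-1 : ℤˣ) ^ (n - (Γ.1 (e, true)).val)) • graphClass k (contract Γ e h)
  else 0

theorem graphClass_relabel (k : Type*) [Field k] {n m : ℕ} (g : Relabeling n m)
    (Γ : OrientedGraph n m) :
    graphClass k (relabel g Γ) = orientationSign g • graphClass k Γ := by
  have h : Finsupp.single (relabel g Γ) (1 : k) - orientationSign g • Finsupp.single Γ 1 ∈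
      relations k n m := Submodule.subset_span ⟨(g, Γ), rfl⟩
  have h' := (Submodule.Quotient.mk_eq_zero _).2 h
  rw [Submodule.Quotient.mk_sub, sub_eq_zero] at h'
  exact h'

/-- A permutation of `n + 1` letters induces a permutation of the remaining letters when one letter
and its image are removed. -/
theorem exists_removed_perm {n : ℕ} (σ : Equiv.Perm (Fin (n + 1))) (w : Fin (n + 1)) :
    ∃ τ : Equiv.Perm (Fin n), (∀ j, σ (w.succAbove j) = (σ w).succAbove (τ j)) ∧
      Equiv.Perm.sign τ = Equiv.Perm.sign σ * (-1) ^ (w.val + (σ w).val) := by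
  set ψ : Equiv.Perm (Fin (n + 1)) := (σ w).cycleRange * σ * w.cycleRange⁻¹ with hψ
  have h0 : ψ 0 = 0 := by
    have : w.cycleRange⁻¹ 0 = w := by
      rw [Equiv.Perm.inv_eq_iff_eq, Fin.cycleRange_self]
    simp only [hψ, Equiv.Perm.mul_apply, this, Fin.cycleRange_self]
  set x := Equiv.Perm.decomposeFin ψ with hx
  have hψx : Equiv.Perm.decomposeFin.symm x = ψ := by rw [hx, Equiv.symm_apply_apply]
  obtain ⟨a, τ⟩ := x
  have ha : a = 0 := by
    have := Equiv.Perm.decomposeFin_symm_apply_zero a τ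
    rw [hψx, h0] at this
    exact this.symm
  subst ha
  refine ⟨τ, fun j => ?_, ?_⟩
  · have h1 : ψ j.succ = (τ j).succ := by
      rw [← hψx, Equiv.Perm.decomposeFin_symm_apply_succ]
      simp
    have h2 : w.cycleRange⁻¹ j.succ = w.succAbove j := by
      rw [Equiv.Perm.inv_eq_iff_eq, Fin.cycleRange_succAbove]
    simp only [hψ, Equiv.Perm.mul_apply, h2] at h1
    rw [← Fin.cycleRange_succAbove (σ w) (τ j)] at h1
    exact (σ w).cycleRange.injective h1
  · have h1 : Equiv.Perm.sign ψ = Equiv.Perm.sign τ := by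
      rw [← hψx, Equiv.Perm.decomposeFin.symm_sign]
      simp
    rw [← h1, hψ]
    simp only [map_mul, Fin.sign_cycleRange, Equiv.Perm.sign_inv, pow_add]
    rw [mul_comm ((-1 : ℤˣ) ^ _), mul_assoc, mul_comm ((-1 : ℤˣ) ^ (σ w).val)]

theorem mergeMap_perm {n : ℕ} (σ : Equiv.Perm (Fin (n + 1))) (τ : Equiv.Perm (Fin n))
    (u w : Fin (n + 1)) (hτ : ∀ j, σ (w.succAbove j) = (σ w).succAbove (τ j)) (h : u ≠ w)
    (h' : σ u ≠ σ w) (x : Fin (n + 1)) :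
    mergeMap (σ u) (σ w) h' (σ x) = τ (mergeMap u w h x) := by
  apply Fin.succAbove_right_injective (p := σ w)
  rw [succAbove_mergeMap, ← hτ, succAbove_mergeMap]
  by_cases hx : x = w <;> simp [hx]

theorem mergeMap_swap {n : ℕ} (u w : Fin (n + 1)) (h : u ≠ w) (x : Fin (n + 1)) :
    mergeMap u w h (Equiv.swap u w x) = mergeMap u w h x := by
  apply Fin.succAbove_right_injective (p := w)
  rw [succAbove_mergeMap, succAbove_mergeMap]
  by_cases hx : x = w
  · simp [hx]
  · by_cases hx' : x = u
    · simp [hx']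
    · rw [Equiv.swap_apply_of_ne_of_ne hx' hx]

theorem halfEdgePerm_symm {m : ℕ} (π : Equiv.Perm (Fin m)) (ρ : Fin m → Bool) (e : Fin m)
    (x : Bool) : (halfEdgePerm π ρ).symm (π e, x) = (e, if ρ e then !x else x) := by
  rw [Equiv.symm_apply_eq]
  by_cases h : ρ e <;> simp [halfEdgePerm, Equiv.prodShear, h]

/-- The common part of the two cases in the next proof. -/
theorem contract_relabel {n m : ℕ} (g : Relabeling (n + 1) (m + 1))
    (Γ : OrientedGraph (n + 1) (m + 1)) (e : Fin (m + 1)) (u w : Fin (n + 1)) (h : u ≠ w)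
    (hu : (relabel g Γ).1 (g.2.1 e, false) = u) (hw : (relabel g Γ).1 (g.2.1 e, true) = w)
    (h1 : Γ.1 (e, false) ≠ Γ.1 (e, true))
    (h2 : (relabel g Γ).1 (g.2.1 e, false) ≠ (relabel g Γ).1 (g.2.1 e, true))
    (τ : Equiv.Perm (Fin n)) (π' : Equiv.Perm (Fin m))
    (hπ : ∀ j, g.2.1 (e.succAbove j) = (g.2.1 e).succAbove (π' j))
    (hτ : ∀ x, mergeMap u w h (g.1 x) = τ (mergeMap (Γ.1 (e, false)) (Γ.1 (e, true)) h1 x)) :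
    contract (relabel g Γ) (g.2.1 e) h2 =
      relabel (τ, π', fun j => g.2.2 (e.succAbove j)) (contract Γ e h1) := by
  subst hu hw
  apply Subtype.ext
  funext ⟨a, c⟩
  obtain ⟨j, rfl⟩ := π'.surjective a
  change mergeMap _ _ h2 ((relabel g Γ).1 ((g.2.1 e).succAbove (π' j), c)) =
    τ ((contract Γ e h1).1
      ((halfEdgePerm π' fun j => g.2.2 (e.succAbove j)).symm (π' j, c)))
  rw [halfEdgePerm_symm, ← hπ]
  change mergeMap _ _ h2 (g.1 (Γ.1 ((halfEdgePerm g.2.1 g.2.2).symm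
    (g.2.1 (e.succAbove j), c)))) = _
  rw [halfEdgePerm_symm, hτ]
  rfl

theorem boundaryTerm_relabel (k : Type*) [Field k] {n m : ℕ} (g : Relabeling (n + 1) (m + 1))
    (Γ : OrientedGraph (n + 1) (m + 1)) (e : Fin (m + 1)) :
    boundaryTerm k (relabel g Γ) (g.2.1 e) = orientationSign g • boundaryTerm k Γ e := by
  have hat : ∀ x, (relabel g Γ).1 (g.2.1 e, x) = g.1 (Γ.1 (e, if g.2.2 e then !x else x)) :=
    fun x => by
      change g.1 (Γ.1 ((halfEdgePerm g.2.1 g.2.2).symm (g.2.1 e, x))) = _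
      rw [halfEdgePerm_symm]
  have hpow : ∀ a b : Fin (n + 1), ((-1 : ℤˣ) ^ (n - b.val)) * (-1) ^ (a.val + b.val) =
      (-1) ^ (n - a.val) := fun a b => by
    have : n - b.val + (a.val + b.val) = (n - a.val) + 2 * a.val := by omega
    rw [← pow_add, this, pow_add, pow_mul]
    simp
  obtain ⟨π', hπ, -⟩ := exists_removed_perm g.2.1 e
  by_cases h1 : Γ.1 (e, false) ≠ Γ.1 (e, true)
  · by_cases hρ : g.2.2 e = true
    · have hu : (relabel g Γ).1 (g.2.1 e, false) = g.1 (Γ.1 (e, true)) := by simp [hat, hρ]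
      have hw : (relabel g Γ).1 (g.2.1 e, true) = g.1 (Γ.1 (e, false)) := by simp [hat, hρ]
      have h' : g.1 (Γ.1 (e, true)) ≠ g.1 (Γ.1 (e, false)) := fun hh =>
        h1 (g.1.injective hh).symm
      have h2 : (relabel g Γ).1 (g.2.1 e, false) ≠ (relabel g Γ).1 (g.2.1 e, true) := by
        rw [hu, hw]; exact h'
      set s := Equiv.swap (Γ.1 (e, false)) (Γ.1 (e, true)) with hs
      obtain ⟨τ, hτ, hsign⟩ := exists_removed_perm (g.1 * s) (Γ.1 (e, true))
      have hsu : (g.1 * s) (Γ.1 (e, false)) = g.1 (Γ.1 (e, true)) := by simp [hs]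
      have hsw : (g.1 * s) (Γ.1 (e, true)) = g.1 (Γ.1 (e, false)) := by simp [hs]
      have hc := contract_relabel g Γ e _ _ h' hu hw h1 h2 τ π' hπ (fun x => by
        have := mergeMap_perm (g.1 * s) τ _ _ hτ h1 (by rw [hsu, hsw]; exact h') (s x)
        rw [show mergeMap _ _ h1 (s x) = mergeMap _ _ h1 x from mergeMap_swap _ _ h1 x] at this
        have hss : (g.1 * s) (s x) = g.1 x := by simp [hs]
        rw [← this]
        simp only [hsu, hsw, hss])
      rw [boundaryTerm, dif_pos h2, boundaryTerm, dif_pos h1, hc, graphClass_relabel,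
        smul_smul, smul_smul]
      congr 1
      rw [orientationSign, orientationSign, Fin.prod_univ_succAbove _ e, hsign, hw, hsw]
      simp only [hρ, if_true, map_mul, hs, Equiv.Perm.sign_swap h1]
      rw [← hpow (Γ.1 (e, true)) (g.1 (Γ.1 (e, false)))]
      simp only [mul_neg, neg_mul, mul_one, one_mul]
      ac_rfl
    · have hu : (relabel g Γ).1 (g.2.1 e, false) = g.1 (Γ.1 (e, false)) := by simp [hat, hρ]
      have hw : (relabel g Γ).1 (g.2.1 e, true) = g.1 (Γ.1 (e, true)) := by simp [hat, hρ]
      have h' : g.1 (Γ.1 (e, false)) ≠ g.1 (Γ.1 (e, true)) := fun hh => h1 (g.1.injective hh)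
      have h2 : (relabel g Γ).1 (g.2.1 e, false) ≠ (relabel g Γ).1 (g.2.1 e, true) := by
        rw [hu, hw]; exact h'
      obtain ⟨τ, hτ, hsign⟩ := exists_removed_perm g.1 (Γ.1 (e, true))
      have hc := contract_relabel g Γ e _ _ h' hu hw h1 h2 τ π' hπ
        (fun x => mergeMap_perm g.1 τ _ _ hτ h1 h' x)
      rw [boundaryTerm, dif_pos h2, boundaryTerm, dif_pos h1, hc, graphClass_relabel,
        smul_smul, smul_smul]
      congr 1
      rw [orientationSign, orientationSign, Fin.prod_univ_succAbove _ e, hsign, hw]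
      simp only [hρ]
      rw [← hpow (Γ.1 (e, true)) (g.1 (Γ.1 (e, true)))]
      simp only [Bool.false_eq_true, if_false, one_mul]
      ac_rfl
  · have h2 : ¬ (relabel g Γ).1 (g.2.1 e, false) ≠ (relabel g Γ).1 (g.2.1 e, true) := by
      rw [not_not] at h1 ⊢
      rw [hat, hat]
      by_cases hρ : g.2.2 e = true <;> simp [hρ, h1]
    rw [boundaryTerm, dif_neg h2, boundaryTerm, dif_neg h1, smul_zero]

/-- The boundary operator of the graph complex, `Γ ↦ ∑ₑ ± Γ/e`. -/
def boundary (k : Type*) [Field k] (n m : ℕ) : Chains k (n + 1) (m + 1) →ₗ[k] Chains k n m :=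
  (relations k (n + 1) (m + 1)).liftQ
    (Finsupp.linearCombination k fun Γ => ∑ e, boundaryTerm k Γ e) (by
      rw [relations, Submodule.span_le]
      rintro _ ⟨⟨g, Γ⟩, rfl⟩
      have hs : ∀ x : OrientedGraph (n + 1) (m + 1) →₀ k,
          Finsupp.linearCombination k (fun Γ => ∑ e, boundaryTerm k Γ e) (orientationSign g • x) =
            orientationSign g •
              Finsupp.linearCombination k (fun Γ => ∑ e, boundaryTerm k Γ e) x := fun x => by
        rw [Units.smul_def, map_zsmul, Units.smul_def]
      rw [SetLike.mem_coe, LinearMap.mem_ker, map_sub, hs, Finsupp.linearCombination_single,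
        Finsupp.linearCombination_single, one_smul, one_smul, sub_eq_zero,
        ← Equiv.sum_comp g.2.1, Finset.smul_sum]
      exact Finset.sum_congr rfl fun e _ => boundaryTerm_relabel k g Γ e)

theorem boundary_graphClass (k : Type*) [Field k] {n m : ℕ} (Γ : OrientedGraph (n + 1) (m + 1)) :
    boundary k n m (graphClass k Γ) = ∑ e, boundaryTerm k Γ e := by
  rw [boundary, graphClass, Submodule.mkQ_apply, Submodule.liftQ_apply,
    Finsupp.linearCombination_single, one_smul]

/-! ### The number attached to an oriented graph -/

/-- A choice of a linear order of the half-edges at each vertex. -/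
abbrev HalfEdgeOrder {n m : ℕ} (Γ : OrientedGraph n m) : Type :=
  ∀ v : Fin n, Fin (valence Γ.1 v) ≃ {h : Fin m × Bool // Γ.1 h = v}

/-- The order of all half-edges in the product of the vertex tensors: first by the vertices, then
by the chosen order at each vertex. -/
def vertexOrder {n m : ℕ} (Γ : OrientedGraph n m) (o : HalfEdgeOrder Γ) (h h' : Fin m × Bool) :
    Prop :=
  Γ.1 h < Γ.1 h' ∨
    (Γ.1 h = Γ.1 h' ∧ ((o (Γ.1 h)).symm ⟨h, rfl⟩).val < ((o (Γ.1 h')).symm ⟨h', rfl⟩).val)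

/-- The order of all half-edges in the product of the edge tensors: first by the edges, then from
the tail to the head of the arrow. -/
def edgeOrder {m : ℕ} (h h' : Fin m × Bool) : Prop :=
  h.1 < h'.1 ∨ (h.1 = h'.1 ∧ h.2 < h'.2)

section StructureConstants

variable {k W : Type*} [Field k] [AddCommGroup W] [Module k W] {𝒲 : ZMod 2 → Submodule k W}
  {ι : Type*}

/-- The lower structure constants `d_{j₁,…,jₛ} = ⟨d_{s-1}(e_{j₁}, …, e_{jₛ₋₁}), e_{jₛ}⟩`, `s ≥ 2`;
these are the components of the tensor placed at a vertex with `s` half-edges. -/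
def lowerConstant (L : LInfinityAlgebra k 𝒲) (B : LinearMap.BilinForm k W)
    (b : Module.Basis ι k W) : (s : ℕ) → (Fin s → ι) → k
  | 0, _ => 0
  | 1, _ => 0
  | r + 2, j => B (L.d r fun i => b (j i.castSucc)) (b (j (Fin.last (r + 1))))

/-- The inverse matrix `k^{ab}` of the matrix `k_{ab} = ⟨e_a, e_b⟩` of the inner product. -/
def inverseGram [Fintype ι] [DecidableEq ι] (B : LinearMap.BilinForm k W)
    (b : Module.Basis ι k W) : Matrix ι ι k :=
  (Matrix.of fun i j => B (b i) (b j))⁻¹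

/-- The number `Z(Γ)`: the graded contraction of the vertex tensors `d_{j₁,…,jₛ}`, in the order of
the vertices, with the edge tensors `k^{ab}`, where `a` belongs to the tail and `b` to the head of
the arrow. The sum is over all labelings `j` of the half-edges by basis vectors, and the Koszul
sign is that of the passage from the order of the half-edges in the product of the vertex tensors to
their order in the product of the edge tensors. The basis vector `b i` is of parity `p i`. -/
def partitionNumber [Fintype ι] [DecidableEq ι] (L : LInfinityAlgebra k 𝒲)
    (B : LinearMap.BilinForm k W) (b : Module.Basis ι k W) (p : ι → ZMod 2) {n m : ℕ}
    (Γ : OrientedGraph n m) (o : HalfEdgeOrder Γ) : k :=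
  ∑ j : Fin m × Bool → ι,
    koszulSign (vertexOrder Γ o) edgeOrder (fun h => p (j h) = 1) •
      ((∏ v : Fin n, lowerConstant L B b (valence Γ.1 v) fun i => j (o v i).1) *
        ∏ e : Fin m, inverseGram B b (j (e, false)) (j (e, true)))

/-- The chain `∑_{Γ ∈ R} Z(Γ)/|Aut Γ| · Γ`. -/
def graphChain [Fintype ι] [DecidableEq ι] (L : LInfinityAlgebra k 𝒲)
    (B : LinearMap.BilinForm k W) (b : Module.Basis ι k W) (p : ι → ZMod 2) {n m : ℕ}
    (R : Finset (OrientedGraph n m)) (o : ∀ Γ : OrientedGraph n m, HalfEdgeOrder Γ) :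
    Chains k n m :=
  ∑ Γ ∈ R, (partitionNumber L B b p Γ (o Γ) / (autCount Γ : k)) • graphClass k Γ

end StructureConstants

end GraphCycle

end

/-! The tensor at a vertex is odd and graded symmetric in all its indices: the operation gives
symmetry in all indices but the last, and invariance together with antisymmetry of the form gives
cyclic symmetry without any sign. The inverse matrix on an edge is even and graded antisymmetric.
Hence the order of half-edges at a vertex is irrelevant, vertices anticommute, edges commute, and a
reversed arrow costs `-1`. This is exactly the behaviour of an orientation
(`partitionNumber_relabel`), so `Z(Γ) Γ` depends only on the isomorphism class of the graph.

By orbit-stabilizer, the sum over classes weighted by `1/|Aut|` is, up to the order of the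
relabeling group, the unweighted sum over all oriented graphs on numbered vertices and edges
(`card_smul_graphChain`). Automorphisms then play no further role.

In the boundary of that sum, a relabeling moves any contracted edge to the edge `0` from vertex `0`
to vertex `1`. The coefficient of a graph `Γ'` is, up to a common sign, the sum of the numbers of
all splittings of the vertex `0` of `Γ'` along a new edge (`sum_graphNumber_isSplitting`). Fix a
half-edge `y` at that vertex. The splittings with `y` at the head of the new edge are given by the
subsets of the other half-edges that stay at the tail. Subsets are unshuffles, and the inverse
matrix on the new edge composes the two operations, so these numbers add up to the L-infinity
relation paired with the label of `y`, which is zero. Flipping the new edge and its ends preserves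
the orientation and exchanges these splittings with those having `y` at the tail. Splittings with a
vertex of valence less than three contribute nothing because `d_1 = 0`.

Connectedness is unchanged by contracting a non-loop, so the cancellation takes place separately
among the connected graphs.

All signs are handled as `listSign`: the half-edges are written in one list, vertex by vertex, and
compared with `edgeOrder`. -/

namespace GraphCycle

/-! ### Signs of lists -/

/-- An irreflexive relation that orients every pair of distinct elements. -/
def IsTournament {H : Type*} (s : H → H → Prop) : Prop :=
  (∀ x, ¬ s x x) ∧ ∀ x y, x ≠ y → (s x y ↔ ¬ s y x)

/-- The sign of the pair `x, y` in this order, compared with the order `s`. -/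
noncomputable def pairSign {H : Type*} (s : H → H → Prop) (q : H → ZMod 2) (x y : H) : ℤˣ :=
  open Classical in if s y x ∧ q x = 1 ∧ q y = 1 then -1 else 1

/-- The product of the signs of the pairs with one element in each of two lists. -/
noncomputable def crossSign {H : Type*} (s : H → H → Prop) (q : H → ZMod 2) (A B : List H) : ℤˣ :=
  (A.map fun x => (B.map fun y => pairSign s q x y).prod).prod

/-- The Koszul sign of the passage from the order of a list to the order `s`. -/
noncomputable def listSign {H : Type*} (s : H → H → Prop) (q : H → ZMod 2) : List H → ℤˣ
  | [] => 1
  | x :: l => (l.map fun y => pairSign s q x y).prod * listSign s q l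

/-- The total parity of a list. -/
def listParity {H : Type*} (q : H → ZMod 2) (l : List H) : ZMod 2 := (l.map q).sum

theorem IsTournament.comap {H K : Type*} {s : H → H → Prop} (hs : IsTournament s) {f : K → H}
    (hf : Function.Injective f) : IsTournament fun x y => s (f x) (f y) :=
  ⟨fun _ => hs.1 _, fun _ _ h => hs.2 _ _ (hf.ne h)⟩

theorem isTournament_lt {α : Type*} [LinearOrder α] : IsTournament fun x y : α => x < y :=
  ⟨fun _ => lt_irrefl _, fun _ _ h => by rw [not_lt]; exact ⟨le_of_lt, fun h' => lt_of_le_of_ne h' h⟩⟩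

theorem units_mul_self (u : ℤˣ) : u * u = 1 := by rw [← sq, Int.units_sq]

theorem paritySign_zero : paritySign 0 = 1 := by simp [paritySign]

theorem paritySign_one : paritySign 1 = -1 := by simp [paritySign]

theorem zmod_two_cases (a : ZMod 2) : a = 0 ∨ a = 1 := by
  revert a; decide

theorem paritySign_add (a b : ZMod 2) : paritySign (a + b) = paritySign a * paritySign b := by
  revert a b; decide

theorem pairSign_congr {H : Type*} {s : H → H → Prop} {q : H → ZMod 2} {x y x' y' : H}
    (h : s y x ↔ s y' x') (hx : q x = q x') (hy : q y = q y') :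
    pairSign s q x y = pairSign s q x' y' := by
  unfold pairSign
  have : (s y x ∧ q x = 1 ∧ q y = 1) ↔ (s y' x' ∧ q x' = 1 ∧ q y' = 1) := by rw [h, hx, hy]
  split_ifs <;> tauto

theorem pairSign_mul_swap {H : Type*} {s : H → H → Prop} (hs : IsTournament s) (q : H → ZMod 2)
    {x y : H} (h : x ≠ y) : pairSign s q x y * pairSign s q y x = paritySign (q x * q y) := by
  have := hs.2 x y h
  rcases zmod_two_cases (q x) with h1 | h1 <;> rcases zmod_two_cases (q y) with h2 | h2 <;>
    by_cases h3 : s y x <;> simp [pairSign, paritySign, h1, h2, h3, this]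

section

variable {H : Type*} {s : H → H → Prop} {q : H → ZMod 2}

theorem listSign_append (A B : List H) :
    listSign s q (A ++ B) = listSign s q A * listSign s q B * crossSign s q A B := by
  induction A with
  | nil => simp [listSign, crossSign]
  | cons x A ih =>
    simp only [List.cons_append, listSign, ih, List.map_append, List.prod_append, crossSign,
      List.map_cons, List.prod_cons]
    ac_rfl

theorem crossSign_perm {A A' B B' : List H} (hA : A.Perm A') (hB : B.Perm B') :
    crossSign s q A B = crossSign s q A' B' := by
  unfold crossSign
  rw [(hA.map _).prod_eq]
  congr 2
  funext x
  exact (hB.map _).prod_eq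

theorem crossSign_append_left (A A' B : List H) :
    crossSign s q (A ++ A') B = crossSign s q A B * crossSign s q A' B := by
  simp [crossSign]

theorem crossSign_append_right (A B B' : List H) :
    crossSign s q A (B ++ B') = crossSign s q A B * crossSign s q A B' := by
  simp [crossSign, List.prod_map_mul]

theorem crossSign_flatten (A : List H) (L : List (List H)) :
    crossSign s q A L.flatten = (L.map (crossSign s q A)).prod := by
  induction L with
  | nil => simp [crossSign]
  | cons B L ih => rw [List.flatten_cons, crossSign_append_right, ih]; simp

/-- Each pair with one element in either list contributes `(-1)^(q x * q y)`, and these exponents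
add up to the product of the total parities. This is the Koszul rule for exchanging two blocks. -/
theorem crossSign_mul_swap (hs : IsTournament s) {A B : List H} (h : A.Disjoint B) :
    crossSign s q A B * crossSign s q B A = paritySign (listParity q A * listParity q B) := by
  induction A with
  | nil => simp [crossSign, listParity, paritySign_zero]
  | cons x A ih =>
    have key : ∀ B : List H, x ∉ B → crossSign s q [x] B * crossSign s q B [x] =
        paritySign (q x * listParity q B) := by
      intro B
      induction B with
      | nil => simp [crossSign, listParity, paritySign_zero]
      | cons y B ihB =>
        intro hx
        simp only [List.mem_cons, not_or] at hx
        have h1 := ihB hx.2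
        have h2 := pairSign_mul_swap hs q hx.1
        simp only [crossSign, listParity, List.map_cons, List.map_nil, List.prod_cons,
          List.prod_nil, mul_one, List.sum_cons, mul_add, paritySign_add] at h1 ⊢
        rw [← h1, ← h2]
        ac_rfl
    rw [show x :: A = [x] ++ A from rfl, crossSign_append_left, crossSign_append_right]
    have h1 := ih (List.disjoint_of_disjoint_cons_left h)
    have h2 := key B (List.disjoint_cons_left.1 h).1
    have : listParity q ([x] ++ A) = q x + listParity q A := by simp [listParity]
    rw [this, add_mul, paritySign_add, ← h1, ← h2]
    ac_rfl

theorem listSign_map {K : Type*} (f : K → H) (l : List K) :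
    listSign s q (l.map f) = listSign (fun x y => s (f x) (f y)) (q ∘ f) l := by
  induction l with
  | nil => rfl
  | cons x l ih =>
    simp only [List.map_cons, listSign, ih, List.map_map]
    rfl

theorem listSign_of_pairwise {l : List H} (h : l.Pairwise fun x y => ¬ s y x) :
    listSign s q l = 1 := by
  induction l with
  | nil => rfl
  | cons x l ih =>
    rw [List.pairwise_cons] at h
    rw [listSign, ih h.2, mul_one]
    refine List.prod_eq_one fun a ha => ?_
    obtain ⟨y, hy, rfl⟩ := List.mem_map.1 ha
    simp [pairSign, h.1 y hy]

/-- A pair of elements of the same parity, standing next to each other in the order `s`, does not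
contribute to the sign. -/
theorem listSign_remove_pair {x y : H} (A B : List H) (hq : q x = q y) (hxy : ¬ s y x)
    (h : ∀ z, z ∈ A ∨ z ∈ B → (s x z ↔ s y z) ∧ (s z x ↔ s z y)) :
    listSign s q (A ++ x :: y :: B) = listSign s q (A ++ B) := by
  have h0 : ∀ B : List H, (∀ z ∈ B, s z x ↔ s z y) →
      (B.map fun z => pairSign s q x z).prod = (B.map fun z => pairSign s q y z).prod := by
    intro B hB
    congr 1
    refine List.map_congr_left fun z hz => ?_
    exact pairSign_congr (hB z hz) hq rfl
  have h1 : pairSign s q x y = 1 := by simp [pairSign, hxy]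
  have h2 : crossSign s q A (x :: y :: B) = crossSign s q A B := by
    unfold crossSign
    congr 1
    refine List.map_congr_left fun z hz => ?_
    have : pairSign s q z x = pairSign s q z y :=
      pairSign_congr (h z (Or.inl hz)).1 rfl hq
    simp only [List.map_cons, List.prod_cons, this, ← mul_assoc, units_mul_self, one_mul]
  rw [listSign_append, listSign_append, h2]
  congr 2
  simp only [listSign, List.map_cons, List.prod_cons, h1, one_mul, ← mul_assoc]
  rw [h0 B fun z hz => (h z (Or.inr hz)).2, units_mul_self, one_mul]

/-- Two odd elements contribute `-1` to the left-hand side exactly when `s` and `s'` disagree on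
them, that is, when exactly one of the two orders disagrees with the list. Transitivity of the
orders is not needed. -/
theorem prod_pairs_eq_listSign {s' : H → H → Prop} (hs : IsTournament s) (hs' : IsTournament s')
    {l : List H} (hl : l.Nodup) :
    (l.map fun x => (l.map fun y =>
      open Classical in if s x y ∧ s' y x ∧ q x = 1 ∧ q y = 1 then (-1 : ℤˣ) else 1).prod).prod =
      listSign s q l * listSign s' q l := by
  classical
  set g : H → H → ℤˣ := fun x y => if s x y ∧ s' y x ∧ q x = 1 ∧ q y = 1 then (-1 : ℤˣ) else 1
    with hg
  have hpair : ∀ x y, x ≠ y → g x y * g y x = pairSign s q x y * pairSign s' q x y := by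
    intro x y h
    have h1 := hs.2 x y h
    have h2 := hs'.2 x y h
    rcases zmod_two_cases (q x) with h3 | h3 <;> rcases zmod_two_cases (q y) with h4 | h4 <;>
      by_cases h5 : s y x <;> by_cases h6 : s' y x <;>
      simp [hg, pairSign, h1, h2, h3, h4, h5, h6]
  have hdiag : ∀ x, g x x = 1 := fun x => by simp [hg, hs.1 x]
  change (l.map fun x => (l.map fun y => g x y).prod).prod = _
  clear_value g
  induction l with
  | nil => simp [listSign]
  | cons x l ih =>
    rw [List.nodup_cons] at hl
    have h2 : (l.map fun y => g x y).prod * (l.map fun y => g y x).prod =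
        (l.map fun y => pairSign s q x y).prod * (l.map fun y => pairSign s' q x y).prod := by
      rw [← List.prod_map_mul, ← List.prod_map_mul]
      congr 1
      refine List.map_congr_left fun y hy => hpair x y ?_
      rintro rfl
      exact hl.1 hy
    have h3 := ih hl.2
    simp only [List.map_cons, List.prod_cons, listSign, hdiag, one_mul, List.prod_map_mul]
    rw [h3, ← mul_assoc, h2]
    ac_rfl

/-- Any enumeration of `H` serves as an intermediate order. One that is sorted for `s` makes the
first factor trivial. -/
theorem koszulSign_eq_listSign [Fintype H] {s' : H → H → Prop} (hs : IsTournament s)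
    (hs' : IsTournament s') {l : List H} (hl : l.Nodup) (hmem : ∀ x, x ∈ l) :
    koszulSign s s' (fun x => q x = 1) = listSign s q l * listSign s' q l := by
  classical
  rw [← prod_pairs_eq_listSign hs hs' hl, koszulSign]
  have huniv : (univ : Finset H) = l.toFinset := by ext x; simp [hmem x]
  rw [huniv, List.prod_toFinset _ hl]
  congr 2
  funext x
  rw [List.prod_toFinset _ hl]
  congr 2
  funext y
  congr

end

theorem koszulSign_comp {H K : Type*} [Fintype H] [Fintype K] (f : K ≃ H) (s s' : H → H → Prop)
    (odd : H → Prop) :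
    koszulSign (fun x y => s (f x) (f y)) (fun x y => s' (f x) (f y)) (fun x => odd (f x)) =
      koszulSign s s' odd := by
  classical
  unfold koszulSign
  rw [← Equiv.prod_comp f]
  refine Finset.prod_congr rfl fun x _ => ?_
  rw [← Equiv.prod_comp f]

/-- All orders are pulled back to `Fin n`, where `List.finRange n` is sorted for `<`. The Koszul
sign between `s` and `<` does not change when both are pulled back along `σ`, and expanding it in
both forms isolates `permSign σ`. -/
theorem listSign_ofFn_comp_perm {H : Type*} {s : H → H → Prop} (hs : IsTournament s)
    (q : H → ZMod 2) {n : ℕ} {t : Fin n → H} (ht : Function.Injective t)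
    (σ : Equiv.Perm (Fin n)) :
    listSign s q (List.ofFn fun i => t (σ i)) =
      permSign σ (fun i => q (t i)) * listSign s q (List.ofFn t) := by
  have hfr : ∀ i : Fin n, i ∈ List.finRange n := List.mem_finRange
  have hnd := List.nodup_finRange n
  have e1 : (List.ofFn fun i => t (σ i)) = (List.finRange n).map fun i => t (σ i) :=
    List.ofFn_eq_map
  have e2 : List.ofFn t = (List.finRange n).map t := List.ofFn_eq_map
  have hst := hs.comap ht
  have hstσ := hst.comap σ.injective
  have hlt : IsTournament fun i j : Fin n => i < j := isTournament_lt
  have hltσ := hlt.comap σ.injective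
  have hsorted : ∀ q', listSign (fun i j : Fin n => i < j) q' (List.finRange n) = 1 := fun q' =>
    listSign_of_pairwise ((List.pairwise_lt_finRange n).imp fun h => h.le.not_gt)
  have a1 := koszulSign_eq_listSign (q := fun i => q (t (σ i))) hstσ hltσ hnd hfr
  have a2 := koszulSign_eq_listSign (q := fun i => q (t i)) hst hlt hnd hfr
  have a3 := koszulSign_eq_listSign (q := fun i => q (t (σ i))) hlt hltσ hnd hfr
  have a4 := koszulSign_comp σ (fun i j => s (t i) (t j)) (fun i j => i < j) fun i => q (t i) = 1
  rw [hsorted, mul_one] at a2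
  rw [hsorted, one_mul] at a3
  rw [a1, a2] at a4
  rw [e1, e2, listSign_map, listSign_map, permSign, a3]
  change listSign _ (fun i => q (t (σ i))) _ = _ * listSign _ (fun i => q (t i)) _
  rw [← a4, mul_comm, mul_assoc, units_mul_self, mul_one]

/-! ### Signs of families of lists -/

theorem listSign_flatten_ofFn {H : Type*} (s : H → H → Prop) (q : H → ZMod 2) {n : ℕ}
    (ls : Fin n → List H) :
    listSign s q (List.ofFn ls).flatten =
      (∏ v, listSign s q (ls v)) * ∏ j, ∏ i ∈ Finset.Iio j, crossSign s q (ls i) (ls j) := by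
  -- The form with `if` suits the induction; the form with `Iio` is the one in which a permutation
  -- of an antisymmetric product yields its sign.
  have hconv : ∀ {n : ℕ} (ls : Fin n → List H),
      ∏ j, ∏ i ∈ Finset.Iio j, crossSign s q (ls i) (ls j) =
        ∏ j, ∏ i, if i < j then crossSign s q (ls i) (ls j) else 1 := by
    intro n ls
    refine Finset.prod_congr rfl fun j _ => ?_
    rw [← Finset.prod_filter]
    refine Finset.prod_congr ?_ fun _ _ => rfl
    ext i; simp
  rw [hconv]
  induction n with
  | zero => simp [listSign]
  | succ n ih =>
    rw [List.ofFn_succ, List.flatten_cons, listSign_append, ih, crossSign_flatten, List.map_ofFn,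
      List.prod_ofFn, Fin.prod_univ_succ, Fin.prod_univ_succ (n := n)]
    simp only [Fin.prod_univ_succ (n := n), Fin.succ_lt_succ_iff, Fin.not_lt_zero, if_false,
      Fin.succ_pos, if_true, Finset.prod_const_one, Finset.prod_mul_distrib, one_mul,
      Function.comp_apply]
    ac_rfl

/-- Lists of odd total parity anticommute. -/
theorem listSign_flatten_perm {H : Type*} {s : H → H → Prop} (hs : IsTournament s)
    {q : H → ZMod 2} {n : ℕ} {ls : Fin n → List H} (hodd : ∀ v, listParity q (ls v) = 1)
    (hdisj : ∀ u v, u ≠ v → (ls u).Disjoint (ls v)) (π : Equiv.Perm (Fin n)) :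
    listSign s q (List.ofFn fun v => ls (π v)).flatten =
      Equiv.Perm.sign π * listSign s q (List.ofFn ls).flatten := by
  rw [listSign_flatten_ofFn, listSign_flatten_ofFn, Equiv.prod_comp π fun v => listSign s q (ls v)]
  -- The signs are taken in `ℤ` with zeros on the diagonal, because antisymmetry is required for `i
  -- = j` too and no unit is its own negative.
  set f : Fin n → Fin n → ℤ := fun i j =>
    if i = j then 0 else ((crossSign s q (ls i) (ls j) : ℤˣ) : ℤ) with hf
  have hanti : ∀ i j, f i j = -f j i := by
    intro i j
    by_cases h : i = j
    · simp [hf, h]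
    · have := crossSign_mul_swap (q := q) hs (hdisj i j h)
      rw [hodd, hodd, one_mul, paritySign_one] at this
      have h2 : crossSign s q (ls i) (ls j) = -crossSign s q (ls j) (ls i) := by
        rw [eq_comm, ← mul_one (crossSign s q (ls i) (ls j)),
          ← units_mul_self (crossSign s q (ls j) (ls i)), ← mul_assoc, this, neg_one_mul]
      simp only [hf, h, Ne.symm h, if_false, h2, Units.val_neg]
  have key := π.prod_Iio_comp_eq_sign_mul_prod hanti
  have h1 : ∀ ρ : Equiv.Perm (Fin n), ∏ j, ∏ i ∈ Finset.Iio j, f (ρ i) (ρ j) =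
      ((∏ j, ∏ i ∈ Finset.Iio j, crossSign s q (ls (ρ i)) (ls (ρ j)) : ℤˣ) : ℤ) := by
    intro ρ
    push_cast
    refine Finset.prod_congr rfl fun j _ => Finset.prod_congr rfl fun i hi => ?_
    have : ρ i ≠ ρ j := fun h => (Finset.mem_Iio.1 hi).ne (ρ.injective h)
    simp [hf, this]
  have h2 := h1 1
  simp only [Equiv.Perm.one_apply] at h2
  rw [h1 π, h2] at key
  have key' : (∏ j, ∏ i ∈ Finset.Iio j, crossSign s q (ls (π i)) (ls (π j))) =
      Equiv.Perm.sign π * ∏ j, ∏ i ∈ Finset.Iio j, crossSign s q (ls i) (ls j) :=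
    Units.ext (by push_cast at key ⊢; exact key)
  rw [key']
  ac_rfl

/-! ### The vertex tensors -/

section VertexTensor

variable {k W : Type*} [Field k] [AddCommGroup W] [Module k W] {𝒲 : ZMod 2 → Submodule k W}
  {ι : Type*}

/-- The component of the vertex tensor with a given list of indices. -/
noncomputable def vertexTensor (L : LInfinityAlgebra k 𝒲) (B : LinearMap.BilinForm k W)
    (b : Module.Basis ι k W) (l : List ι) : k :=
  lowerConstant L B b l.length l.get

theorem lowerConstant_congr (L : LInfinityAlgebra k 𝒲) (B : LinearMap.BilinForm k W)
    (b : Module.Basis ι k W) {s s' : ℕ} (h : s = s') {f : Fin s → ι} {f' : Fin s' → ι}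
    (hf : ∀ i, f i = f' (Fin.cast h i)) : lowerConstant L B b s f = lowerConstant L B b s' f' := by
  subst h
  congr 1
  funext i
  exact hf i

variable {L : LInfinityAlgebra k 𝒲} {B : LinearMap.BilinForm k W} {b : Module.Basis ι k W}

theorem vertexTensor_ofFn {n : ℕ} (f : Fin n → ι) :
    vertexTensor L B b (List.ofFn f) = lowerConstant L B b n f :=
  lowerConstant_congr L B b List.length_ofFn fun i => List.get_ofFn f i

theorem vertexTensor_ofFn_append {r : ℕ} (f : Fin (r + 1) → ι) (y : ι) :
    vertexTensor L B b (List.ofFn f ++ [y]) = B (L.d r fun i => b (f i)) (b y) := by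
  have : List.ofFn f ++ [y] = List.ofFn (Fin.snoc f y : Fin (r + 2) → ι) := by
    conv_rhs => rw [List.ofFn_succ_last]
    simp only [Fin.snoc_castSucc, Fin.snoc_last]
  rw [this, vertexTensor_ofFn, lowerConstant]
  simp

theorem exists_eq_ofFn {α : Type*} {l : List α} {n : ℕ} (h : l.length = n) :
    ∃ f : Fin n → α, l = List.ofFn f := by
  subst h
  exact ⟨l.get, (List.ofFn_get l).symm⟩

theorem vertexTensor_eq_zero_of_length (hd : L.d 0 = 0) {l : List ι} (h : l.length < 3) :
    vertexTensor L B b l = 0 := by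
  obtain ⟨f, hf⟩ := exists_eq_ofFn (rfl : l.length = l.length)
  generalize l.length = n at *
  subst hf
  rw [vertexTensor_ofFn]
  rcases n with _ | _ | _ | n
  · rfl
  · rfl
  · simp [lowerConstant, hd]
  · omega

theorem paritySum_of_form_ne_zero (hB : IsInvariantInnerProduct L B) {p p' : ZMod 2} {x y : W}
    (hx : x ∈ 𝒲 p) (hy : y ∈ 𝒲 p') (h : B x y ≠ 0) : p = p' := by
  by_contra hne
  exact h (hB.even p p' x y hx hy hne)

theorem listParity_of_vertexTensor_ne_zero (hB : IsInvariantInnerProduct L B) {p : ι → ZMod 2}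
    (hb : ∀ i, b i ∈ 𝒲 (p i)) {l : List ι} (h : vertexTensor L B b l ≠ 0) :
    listParity p l = 1 := by
  obtain ⟨f, hf⟩ := exists_eq_ofFn (rfl : l.length = l.length)
  generalize l.length = n at *
  subst hf
  rw [vertexTensor_ofFn] at h
  rw [listParity, List.map_ofFn, List.sum_ofFn]
  rcases n with _ | _ | n
  · exact absurd rfl h
  · exact absurd rfl h
  · have := paritySum_of_form_ne_zero hB (L.odd n (fun i => p (f i.castSucc)) _ fun i => hb _)
      (hb _) h
    rw [Fin.sum_univ_castSucc]
    simp only [Function.comp_apply]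
    rw [← this, ← add_assoc, CharTwo.add_self_eq_zero, zero_add]

/-- Invariance and antisymmetry contribute one minus sign each. The form pairs only equal parities,
so the remaining sign is `(-1)^(p x + p x ^ 2) = 1`. -/
theorem vertexTensor_rotate (hB : IsInvariantInnerProduct L B) {p : ι → ZMod 2}
    (hb : ∀ i, b i ∈ 𝒲 (p i)) (x : ι) (l : List ι) :
    vertexTensor L B b (x :: l) = vertexTensor L B b (l ++ [x]) := by
  obtain ⟨f, hf⟩ := exists_eq_ofFn (rfl : l.length = l.length)
  generalize l.length = n at *
  subst hf
  rcases n with _ | r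
  · simp
  rw [vertexTensor_ofFn_append]
  have h1 : x :: List.ofFn f = List.ofFn (Fin.cons x f : Fin (r + 2) → ι) := by
    rw [List.ofFn_succ]; simp
  set w : Fin (r + 2) → ι := Fin.cons x f with hw
  have h2 := hB.invariant r (fun i => p (w i)) (fun i => b (w i)) fun i => hb _
  have h3 := L.odd r (fun i => p (f i)) (fun i => b (f i)) fun i => hb _
  have h4 := hB.antisymmetric _ _ _ _ h3 (hb x)
  rw [h1, vertexTensor_ofFn, lowerConstant, h2]
  simp only [hw, Fin.cons_zero, Fin.cons_succ]
  rw [h4, smul_neg, neg_neg, smul_smul, ← paritySign_add]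
  by_cases h0 : B (L.d r fun i => b (f i)) (b x) = 0
  · rw [h0, smul_zero]
  · have h5 := paritySum_of_form_ne_zero hB h3 (hb x) h0
    rw [h5, ← sq]
    have : p x + p x ^ 2 = 0 := by generalize p x = a; revert a; decide
    rw [this, paritySign_zero, one_smul]

theorem vertexTensor_append_comm (hB : IsInvariantInnerProduct L B) {p : ι → ZMod 2}
    (hb : ∀ i, b i ∈ 𝒲 (p i)) (l l' : List ι) :
    vertexTensor L B b (l ++ l') = vertexTensor L B b (l' ++ l) := by
  induction l generalizing l' with
  | nil => simp
  | cons x l ih =>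
    rw [List.cons_append, vertexTensor_rotate hB hb, List.append_assoc, ih, List.append_assoc]
    rfl

theorem exists_perm_of_nodup {α : Type*} {l l' : List α} (hl : l.Nodup) (h : l.Perm l') :
    ∃ σ : Equiv.Perm (Fin l.length), l' = List.ofFn fun i => l.get (σ i) := by
  classical
  have hl' : l'.Nodup := h.nodup_iff.1 hl
  let e : {x // x ∈ l'} ≃ {x // x ∈ l} := Equiv.subtypeEquivRight fun x => h.mem_iff.symm
  let σ : Equiv.Perm (Fin l.length) :=
    ((finCongr h.length_eq).trans (hl'.getEquiv l')).trans (e.trans (hl.getEquiv l).symm)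
  refine ⟨σ, ?_⟩
  have key : ∀ i, l.get (σ i) = l'.get (Fin.cast h.length_eq i) := by
    intro i
    have : (hl.getEquiv l) (σ i) = e (hl'.getEquiv l' (Fin.cast h.length_eq i)) := by
      simp [σ]
    exact congrArg Subtype.val this
  apply List.ext_get
  · simp [h.length_eq]
  · intro n h1 h2
    rw [List.get_ofFn, key]
    rfl

/-! ### Graded symmetry of the vertex tensors -/

section Symmetry

variable {H : Type*} {s : H → H → Prop}

/-- With the last entry fixed, only the arguments of the operation are permuted, and its graded
symmetry produces the same `permSign` as the list. -/
theorem listSign_smul_vertexTensor_perm_init (hs : IsTournament s) {p : ι → ZMod 2}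
    (hb : ∀ i, b i ∈ 𝒲 (p i)) (j : H → ι) {l l' : List H} (hl : l.Nodup) (h : l.Perm l') (y : H) :
    listSign s (p ∘ j) (l ++ [y]) • vertexTensor L B b ((l ++ [y]).map j) =
      listSign s (p ∘ j) (l' ++ [y]) • vertexTensor L B b ((l' ++ [y]).map j) := by
  obtain ⟨σ, hσ⟩ := exists_perm_of_nodup hl h
  have hinj : Function.Injective l.get := List.nodup_iff_injective_get.1 hl
  have h0 : crossSign s (p ∘ j) l [y] = crossSign s (p ∘ j) l' [y] :=
    crossSign_perm h (List.Perm.refl _)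
  have h1 := listSign_ofFn_comp_perm hs (p ∘ j) hinj σ
  rw [listSign_append, listSign_append, h0, hσ, h1, List.ofFn_get]
  have h2 : vertexTensor L B b ((l ++ [y]).map j) =
      permSign σ (fun i => p (j (l.get i))) •
        vertexTensor L B b (((List.ofFn fun i => l.get (σ i)) ++ [y]).map j) := by
    have e1 : (l ++ [y]).map j = List.ofFn (fun i => j (l.get i)) ++ [j y] := by
      conv_lhs => rw [← List.ofFn_get l]
      simp
    have e2 : ((List.ofFn fun i => l.get (σ i)) ++ [y]).map j =
        List.ofFn (fun i => j (l.get (σ i))) ++ [j y] := by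
      simp [List.map_ofFn, Function.comp_def]
    rw [e1, e2]
    clear h1 hσ e1 e2 h0 hinj
    generalize l.get = t at *
    generalize l.length = n at *
    rcases n with _ | r
    -- A list of length one involves no operation; its tensor is zero by convention.
    · have e : ∀ x : ι, vertexTensor L B b [x] = 0 := fun x => rfl
      simp only [List.ofFn_zero, List.nil_append, e, smul_zero]
    · rw [vertexTensor_ofFn_append, vertexTensor_ofFn_append,
        L.symmetric r σ (fun i => p (j (t i))) _ fun i => hb _, Units.smul_def, Units.smul_def,
        map_zsmul, LinearMap.smul_apply]
  rw [h2, smul_smul]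
  congr 1
  simp only [Function.comp_apply]
  ac_rfl

/-- If the total parity is odd, one of the two blocks is even, and an even block commutes with
everything. -/
theorem listSign_append_comm {q : H → ZMod 2} (hs : IsTournament s) {l l' : List H}
    (hdisj : l.Disjoint l') (h : listParity q l + listParity q l' = 1) :
    listSign s q (l ++ l') = listSign s q (l' ++ l) := by
  have h1 := crossSign_mul_swap (q := q) hs hdisj
  have h2 : listParity q l * listParity q l' = 0 := by
    have hz : ∀ a c : ZMod 2, a + c = 1 → a * c = 0 := by decide
    exact hz _ _ h
  rw [h2, paritySign_zero] at h1
  have h3 : crossSign s q l l' = crossSign s q l' l := by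
    rw [← mul_one (crossSign s q l l'), ← units_mul_self (crossSign s q l' l), ← mul_assoc, h1,
      one_mul]
  rw [listSign_append, listSign_append, h3, mul_comm (listSign s q l)]

theorem listSign_smul_vertexTensor_append_comm (hB : IsInvariantInnerProduct L B)
    (hs : IsTournament s) {p : ι → ZMod 2} (hb : ∀ i, b i ∈ 𝒲 (p i)) (j : H → ι) {l l' : List H}
    (hdisj : l.Disjoint l') :
    listSign s (p ∘ j) (l ++ l') • vertexTensor L B b ((l ++ l').map j) =
      listSign s (p ∘ j) (l' ++ l) • vertexTensor L B b ((l' ++ l).map j) := by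
  rw [List.map_append, List.map_append, vertexTensor_append_comm hB hb]
  by_cases h0 : vertexTensor L B b (l'.map j ++ l.map j) = 0
  · rw [h0, smul_zero, smul_zero]
  · have := listParity_of_vertexTensor_ne_zero hB hb h0
    rw [listSign_append_comm hs hdisj]
    rw [← this]
    simp only [listParity, List.map_map, List.map_append, List.sum_append]
    rw [add_comm]

/-- The vertex tensors are graded symmetric. -/
theorem listSign_smul_vertexTensor_perm (hB : IsInvariantInnerProduct L B)
    (hs : IsTournament s) {p : ι → ZMod 2} (hb : ∀ i, b i ∈ 𝒲 (p i)) (j : H → ι) {l l' : List H}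
    (hl : l.Nodup) (h : l.Perm l') :
    listSign s (p ∘ j) l • vertexTensor L B b (l.map j) =
      listSign s (p ∘ j) l' • vertexTensor L B b (l'.map j) := by
  rcases List.eq_nil_or_concat l with rfl | ⟨l₀, y, rfl⟩
  · rw [List.nil_perm.1 h]
  · rw [List.concat_eq_append] at *
    have hl' : l'.Nodup := h.nodup_iff.1 hl
    obtain ⟨A, C, rfl⟩ := List.append_of_mem (h.mem_iff.1 (by simp : y ∈ l₀ ++ [y]))
    -- A rotation brings the block behind `y` to the front. Then both lists end in `y`, and the
    -- symmetry of the operation applies.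
    have e : A ++ y :: C = (A ++ [y]) ++ C := by simp
    rw [e] at h hl' ⊢
    rw [listSign_smul_vertexTensor_append_comm hB hs hb j (List.disjoint_of_nodup_append hl'),
      ← List.append_assoc]
    refine listSign_smul_vertexTensor_perm_init hs hb j (List.nodup_append.1 hl).1 ?_ y
    rw [← List.perm_append_right_iff [y]]
    refine h.trans ?_
    rw [List.append_assoc C]
    exact List.perm_append_comm

end Symmetry

/-! ### The edge tensor -/

section EdgeTensor

variable [Fintype ι] [DecidableEq ι]

theorem isUnit_det_gram (hB : IsInvariantInnerProduct L B) :
    IsUnit (Matrix.of fun i j => B (b i) (b j)).det := by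
  have h := (LinearMap.BilinForm.nondegenerate_iff_det_ne_zero b).1 hB.nondegenerate
  have e : (LinearMap.BilinForm.toMatrix b) B = Matrix.of fun i j => B (b i) (b j) := by
    ext i j; simp [LinearMap.BilinForm.toMatrix_apply]
  rw [e] at h
  exact isUnit_iff_ne_zero.2 h

/-- This is how edges enter the L-infinity relation: inserting one operation into another amounts to
contracting two vertex tensors with the inverse matrix. -/
theorem repr_eq_sum_inverseGram (hB : IsInvariantInnerProduct L B) (x : W) (c : ι) :
    b.repr x c = ∑ e, B x (b e) * inverseGram B b e c := by
  set M : Matrix ι ι k := Matrix.of fun i j => B (b i) (b j) with hM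
  have h1 : ∀ e, B x (b e) = Matrix.vecMul (fun i => b.repr x i) M e := by
    intro e
    have := congrArg (fun z => B z (b e)) (b.sum_repr x)
    simp only [map_sum, map_smul, LinearMap.sum_apply, LinearMap.smul_apply] at this
    exact this.symm
  have h2 : Matrix.vecMul (Matrix.vecMul (fun i => b.repr x i) M) M⁻¹ = fun i => b.repr x i := by
    rw [Matrix.vecMul_vecMul, Matrix.mul_nonsing_inv _ (isUnit_det_gram hB), Matrix.vecMul_one]
  rw [← congrFun h2 c]
  simp only [h1]
  rfl

theorem coe_paritySign_mul_self (a : ZMod 2) :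
    (((paritySign a : ℤˣ) : ℤ) : k) * (((paritySign a : ℤˣ) : ℤ) : k) = 1 := by
  rw [← Int.cast_mul, ← Units.val_mul, units_mul_self]; simp

/-- Evenness of the form means that its matrix is fixed under conjugation by the diagonal matrix of
parity signs, a property that passes to the inverse. -/
theorem inverseGram_conj (hB : IsInvariantInnerProduct L B) {p : ι → ZMod 2}
    (hb : ∀ i, b i ∈ 𝒲 (p i)) :
    Matrix.diagonal (fun i => (((paritySign (p i) : ℤˣ) : ℤ) : k)) * inverseGram B b *
      Matrix.diagonal (fun i => (((paritySign (p i) : ℤˣ) : ℤ) : k)) = inverseGram B b := by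
  set D : Matrix ι ι k := Matrix.diagonal (fun i => (((paritySign (p i) : ℤˣ) : ℤ) : k)) with hD
  set M : Matrix ι ι k := Matrix.of fun i j => B (b i) (b j) with hM
  have hDD : D * D = 1 := by
    rw [hD, Matrix.diagonal_mul_diagonal]
    simp [coe_paritySign_mul_self]
  have hDM : D * M * D = M := by
    ext i j
    rw [hD, Matrix.mul_diagonal, Matrix.diagonal_mul]
    by_cases h : p i = p j
    · rw [h, mul_right_comm, coe_paritySign_mul_self, one_mul]
    · simp [hM, hB.even _ _ _ _ (hb i) (hb j) h]
  have hDinv : D⁻¹ = D := Matrix.inv_eq_left_inv hDD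
  have h := congrArg (fun X => X⁻¹) hDM
  simp only [Matrix.mul_inv_rev, hDinv] at h
  rw [← mul_assoc] at h
  exact h

/-- The conjugation changes the sign of an entry between different parities, so this entry equals
its own negative. -/
theorem inverseGram_even [CharZero k] (hB : IsInvariantInnerProduct L B) {p : ι → ZMod 2}
    (hb : ∀ i, b i ∈ 𝒲 (p i)) {i j : ι} (h : p i ≠ p j) : inverseGram B b i j = 0 := by
  have h1 := congrFun (congrFun (inverseGram_conj (b := b) hB hb) i) j
  rw [Matrix.mul_diagonal, Matrix.diagonal_mul] at h1
  have h2 : (paritySign (p i) : ℤˣ) * paritySign (p j) = -1 := by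
    rw [← paritySign_add]
    have : p i + p j = 1 := by
      have hz : ∀ a c : ZMod 2, a ≠ c → a + c = 1 := by decide
      exact hz _ _ h
    rw [this, paritySign_one]
  have h3 : (((paritySign (p i) : ℤˣ) : ℤ) : k) * (((paritySign (p j) : ℤˣ) : ℤ) : k) = -1 := by
    rw [← Int.cast_mul, ← Units.val_mul, h2]; simp
  rw [mul_right_comm, h3, neg_one_mul] at h1
  exact self_eq_neg.1 h1.symm

/-- For an even form, graded antisymmetry reads `Mᵀ = -D * M` with `D` the diagonal matrix of parity
signs. Inverting both sides gives the same symmetry for the inverse. -/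
theorem inverseGram_antisymm [CharZero k] (hB : IsInvariantInnerProduct L B) {p : ι → ZMod 2}
    (hb : ∀ i, b i ∈ 𝒲 (p i)) (i j : ι) :
    inverseGram B b j i = -(paritySign (p i * p j) • inverseGram B b i j) := by
  by_cases hij : p i = p j
  swap
  · rw [inverseGram_even hB hb hij, inverseGram_even hB hb (Ne.symm hij)]; simp
  set D : Matrix ι ι k := Matrix.diagonal (fun i => (((paritySign (p i) : ℤˣ) : ℤ) : k)) with hD
  set M : Matrix ι ι k := Matrix.of fun i j => B (b i) (b j) with hM
  have hDD : D * D = 1 := by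
    rw [hD, Matrix.diagonal_mul_diagonal]
    simp [coe_paritySign_mul_self]
  have hsq : ∀ a : ZMod 2, a * a = a := by decide
  have hMT : M.transpose = -D * M := by
    ext i j
    rw [neg_mul, Matrix.neg_apply, hD, Matrix.diagonal_mul, Matrix.transpose_apply]
    change B (b j) (b i) = -(_ * B (b i) (b j))
    rw [hB.antisymmetric _ _ _ _ (hb i) (hb j), Units.smul_def, zsmul_eq_mul]
    by_cases h : p i = p j
    · rw [h, hsq]
    · simp [hB.even _ _ _ _ (hb i) (hb j) h]
  have hDinv : (-D)⁻¹ = -D := Matrix.inv_eq_left_inv (by rw [neg_mul_neg, hDD])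
  have h := congrArg (fun X => X⁻¹) hMT
  simp only [Matrix.mul_inv_rev, hDinv] at h
  rw [← Matrix.transpose_nonsing_inv] at h
  have h1 := congrFun (congrFun h i) j
  rw [mul_neg, Matrix.neg_apply, hD, Matrix.mul_diagonal, Matrix.transpose_apply] at h1
  change inverseGram B b j i = -(inverseGram B b i j * _) at h1
  rw [h1, hij, hsq, Units.smul_def, zsmul_eq_mul, mul_comm]

/-- The L-infinity relation in terms of the tensors. -/
theorem sum_unshuffles_vertexTensor (hB : IsInvariantInnerProduct L B) {p : ι → ZMod 2}
    (hb : ∀ i, b i ∈ 𝒲 (p i)) (N : ℕ) (w : Fin (N + 1) → ι) (y : ι) :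
    ∑ a : Fin (N + 1), ∑ σ ∈ unshuffles (a.val + 1) (N + 1), permSign σ (fun i => p (w i)) •
      ∑ c, ∑ e, vertexTensor L B b
          ((List.ofFn fun i : Fin (a.val + 1) => w (σ ⟨i.val, by omega⟩)) ++ [e]) *
        inverseGram B b e c *
        vertexTensor L B b
          (c :: ((List.ofFn fun i : Fin (N - a.val) => w (σ ⟨a.val + 1 + i.val, by omega⟩)) ++
            [y])) = 0 := by
  have h := L.relation N (fun i => p (w i)) (fun i => b (w i)) fun i => hb _
  have h1 := congrArg (fun x => B x (b y)) h
  simp only [linfinityRelator, map_zero, LinearMap.zero_apply, map_sum, LinearMap.sum_apply,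
    Units.smul_def, map_zsmul, LinearMap.smul_apply] at h1
  rw [← h1]
  refine Finset.sum_congr rfl fun a _ => Finset.sum_congr rfl fun σ _ => ?_
  rw [Units.smul_def]
  congr 1
  set X := L.d a.val fun i : Fin (a.val + 1) => b (w (σ ⟨i.val, by omega⟩)) with hX
  set v : Fin (N - a.val) → ι := fun i => w (σ ⟨a.val + 1 + i.val, by omega⟩) with hv
  -- The inner value `X` is expanded in the basis by linearity in the first argument; its
  -- coordinates then become sums over the inverse matrix.
  have h2 : L.d (N - a.val) (Fin.cons X fun i => b (v i)) =
      ∑ c, b.repr X c • L.d (N - a.val) (Fin.cons (b c) fun i => b (v i)) := by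
    have e : ∀ z, L.d (N - a.val) (Fin.cons z fun i => b (v i)) =
        (L.d (N - a.val)).curryLeft z fun i => b (v i) := fun z => rfl
    simp only [e]
    have h3 := congrArg (fun z => (L.d (N - a.val)).curryLeft z fun i => b (v i)) (b.sum_repr X)
    simp only [map_sum, map_smul, _root_.sum_apply, _root_.smul_apply] at h3
    exact h3.symm
  rw [h2, map_sum, LinearMap.sum_apply]
  refine Finset.sum_congr rfl fun c _ => ?_
  rw [map_smul, LinearMap.smul_apply, smul_eq_mul, repr_eq_sum_inverseGram hB, Finset.sum_mul]
  refine Finset.sum_congr rfl fun e _ => ?_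
  rw [vertexTensor_ofFn_append]
  congr 1
  have e1 : c :: (List.ofFn v ++ [y]) =
      List.ofFn (Fin.cons c v : Fin (N - a.val + 1) → ι) ++ [y] := by
    rw [List.ofFn_succ]; simp
  rw [e1, vertexTensor_ofFn_append]
  congr 3
  funext i
  refine Fin.cases ?_ (fun i => ?_) i <;> simp

end EdgeTensor

end VertexTensor

/-! ### Graphs with lists of half-edges at the vertices -/

theorem isTournament_edgeOrder {m : ℕ} : IsTournament (edgeOrder (m := m)) := by
  refine ⟨fun x h => ?_, fun x y hxy => ?_⟩
  · rcases h with h | h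
    · exact lt_irrefl _ h
    · exact lt_irrefl _ h.2
  · obtain ⟨a, c⟩ := x
    obtain ⟨a', c'⟩ := y
    rcases lt_trichotomy a a' with h | h | h
    · simp [edgeOrder, h, h.not_gt, h.ne']
    · subst h
      have hc : c ≠ c' := fun h => hxy (by rw [h])
      rcases lt_trichotomy c c' with h | h | h
      · simp only [edgeOrder, lt_irrefl, true_and, false_or, h, h.not_gt]; tauto
      · exact absurd h hc
      · simp only [edgeOrder, lt_irrefl, true_and, false_or, h, h.not_gt]; tauto
    · simp [edgeOrder, h, h.not_gt, h.ne']

/-- The lists `ls v` enumerate the fibers of `f`. -/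
def IsFiberList {H : Type*} {n : ℕ} (f : H → Fin n) (ls : Fin n → List H) : Prop :=
  ∀ v, (ls v).Nodup ∧ ∀ h, h ∈ ls v ↔ f h = v

namespace IsFiberList

variable {H : Type*} {n : ℕ} {f : H → Fin n} {ls ls' : Fin n → List H}

theorem perm (h : IsFiberList f ls) (h' : IsFiberList f ls') (v : Fin n) :
    (ls v).Perm (ls' v) :=
  (List.perm_ext_iff_of_nodup (h v).1 (h' v).1).2 fun x => by rw [(h v).2, (h' v).2]

theorem disjoint (h : IsFiberList f ls) {u v : Fin n} (huv : u ≠ v) : (ls u).Disjoint (ls v) :=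
  fun x hu hv => huv (((h u).2 x).1 hu ▸ ((h v).2 x).1 hv)

theorem nodup_flatten (h : IsFiberList f ls) : (List.ofFn ls).flatten.Nodup := by
  rw [List.nodup_flatten]
  refine ⟨fun l hl => ?_, ?_⟩
  · obtain ⟨v, rfl⟩ := List.mem_ofFn.1 hl
    exact (h v).1
  · rw [List.pairwise_ofFn]
    exact fun i j hij => h.disjoint hij.ne

theorem mem_flatten (h : IsFiberList f ls) (x : H) : x ∈ (List.ofFn ls).flatten :=
  List.mem_flatten.2 ⟨ls (f x), List.mem_ofFn.2 ⟨_, rfl⟩, ((h _).2 x).2 rfl⟩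

theorem length_eq {m : ℕ} {f : Fin m × Bool → Fin n} {ls : Fin n → List (Fin m × Bool)}
    (h : IsFiberList f ls) (v : Fin n) : (ls v).length = valence f v := by
  classical
  rw [valence, Fintype.card_subtype, ← List.toFinset_card_of_nodup (h v).1]
  congr 1
  ext x
  simp [(h v).2]

end IsFiberList

/-- The list of the fibers of a map from a finite type. -/
noncomputable def fiberList {H : Type*} [Fintype H] {n : ℕ} (f : H → Fin n) (v : Fin n) : List H :=
  open Classical in (univ.filter fun h => f h = v).toList

theorem isFiberList_fiberList {H : Type*} [Fintype H] {n : ℕ} (f : H → Fin n) :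
    IsFiberList f (fiberList f) := fun v =>
  ⟨Finset.nodup_toList _, fun h => by simp [fiberList]⟩

theorem isFiberList_halfEdgeOrder {n m : ℕ} (Γ : OrientedGraph n m) (o : HalfEdgeOrder Γ) :
    IsFiberList Γ.1 fun v => List.ofFn fun i => (o v i).1 := by
  refine fun v => ⟨List.nodup_ofFn.2 (Subtype.val_injective.comp (o v).injective), fun h => ?_⟩
  rw [List.mem_ofFn]
  constructor
  · rintro ⟨i, rfl⟩
    exact (o v i).2
  · intro hv
    exact ⟨(o v).symm ⟨h, hv⟩, by simp⟩

/-! ### The order of the half-edges by vertices -/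

section VertexOrder

variable {n m : ℕ} (Γ : OrientedGraph n m) (o : HalfEdgeOrder Γ)

theorem halfEdgeOrder_position (v : Fin n) (i : Fin (valence Γ.1 v)) :
    ((o (Γ.1 (o v i).1)).symm ⟨(o v i).1, rfl⟩).val = i.val := by
  -- The type of the position depends on the vertex of the half-edge. For a general vertex `v` the
  -- equation `Γ x = v` can be substituted.
  have key : ∀ (v : Fin n) (x : {h : Fin m × Bool // Γ.1 h = v}),
      ((o (Γ.1 x.1)).symm ⟨x.1, rfl⟩).val = ((o v).symm x).val := by
    rintro v ⟨x, rfl⟩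
    rfl
  rw [key, Equiv.symm_apply_apply]

theorem vertexOrder_apply (u v : Fin n) (i : Fin (valence Γ.1 u)) (i' : Fin (valence Γ.1 v)) :
    vertexOrder Γ o (o u i).1 (o v i').1 ↔ u < v ∨ (u = v ∧ i.val < i'.val) := by
  rw [vertexOrder, halfEdgeOrder_position, halfEdgeOrder_position, (o u i).2, (o v i').2]

theorem exists_eq_halfEdgeOrder (h : Fin m × Bool) : ∃ v i, h = (o v i).1 :=
  ⟨Γ.1 h, (o (Γ.1 h)).symm ⟨h, rfl⟩, by simp⟩

theorem isTournament_vertexOrder : IsTournament (vertexOrder Γ o) := by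
  refine ⟨fun x => ?_, fun x y => ?_⟩
  · obtain ⟨v, i, rfl⟩ := exists_eq_halfEdgeOrder Γ o x
    simp [vertexOrder_apply]
  · obtain ⟨u, i, rfl⟩ := exists_eq_halfEdgeOrder Γ o x
    obtain ⟨v, i', rfl⟩ := exists_eq_halfEdgeOrder Γ o y
    intro hne
    rw [vertexOrder_apply, vertexOrder_apply]
    rcases lt_trichotomy u v with h | h | h
    · simp [h, h.not_gt, h.ne']
    · subst h
      have : i.val ≠ i'.val := fun h => hne (by rw [Fin.ext h])
      simp only [lt_irrefl, true_and, false_or]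
      omega
    · simp [h, h.not_gt, h.ne']

theorem pairwise_vertexOrder :
    ((List.ofFn fun v => List.ofFn fun i => (o v i).1).flatten).Pairwise
      fun x y => ¬ vertexOrder Γ o y x := by
  rw [List.pairwise_flatten]
  refine ⟨fun l hl => ?_, ?_⟩
  · obtain ⟨v, rfl⟩ := List.mem_ofFn.1 hl
    rw [List.pairwise_ofFn]
    intro i i' hi
    rw [vertexOrder_apply]
    simp [hi.le]
  · rw [List.pairwise_ofFn]
    intro u v huv x hx y hy
    obtain ⟨i, rfl⟩ := List.mem_ofFn.1 hx
    obtain ⟨i', rfl⟩ := List.mem_ofFn.1 hy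
    rw [vertexOrder_apply]
    simp [huv.not_gt, huv.ne']

end VertexOrder

/-! ### The graded contraction and its change under relabelings -/

section Contraction

variable {k W : Type*} [Field k] [AddCommGroup W] [Module k W] {𝒲 : ZMod 2 → Submodule k W}
  {ι : Type*} [Fintype ι] [DecidableEq ι]

/-- The product of the components of the vertex tensors and of the edge tensors that belong to a
labeling of the half-edges, where `ls v` is the list of the half-edges at `v`. -/
noncomputable def labelTerm (L : LInfinityAlgebra k 𝒲)
    (B : LinearMap.BilinForm k W) (b : Module.Basis ι k W) (p : ι → ZMod 2) {n m : ℕ}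
    (ls : Fin n → List (Fin m × Bool)) (j : Fin m × Bool → ι) : k :=
  listSign edgeOrder (p ∘ j) (List.ofFn ls).flatten •
    ((∏ v, vertexTensor L B b ((ls v).map j)) *
      ∏ e : Fin m, inverseGram B b (j (e, false)) (j (e, true)))

/-- The graded contraction of the vertex tensors with the edge tensors, where `ls v` is the list of
the half-edges at `v`. -/
noncomputable def contraction (L : LInfinityAlgebra k 𝒲)
    (B : LinearMap.BilinForm k W) (b : Module.Basis ι k W) (p : ι → ZMod 2) {n m : ℕ}
    (ls : Fin n → List (Fin m × Bool)) : k :=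
  ∑ j : Fin m × Bool → ι, labelTerm L B b p ls j

variable {L : LInfinityAlgebra k 𝒲} {B : LinearMap.BilinForm k W} {b : Module.Basis ι k W}
  {p : ι → ZMod 2} {n m : ℕ}

/-- The concatenated list is sorted for `vertexOrder`, so only its sign with respect to `edgeOrder`
survives. -/
theorem partitionNumber_eq_contraction (Γ : OrientedGraph n m) (o : HalfEdgeOrder Γ) :
    partitionNumber L B b p Γ o = contraction L B b p fun v => List.ofFn fun i => (o v i).1 := by
  refine Finset.sum_congr rfl fun j _ => ?_
  have hfl := isFiberList_halfEdgeOrder Γ o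
  have h1 := koszulSign_eq_listSign (q := p ∘ j) (isTournament_vertexOrder Γ o)
    isTournament_edgeOrder hfl.nodup_flatten hfl.mem_flatten
  rw [listSign_of_pairwise (pairwise_vertexOrder Γ o), one_mul] at h1
  rw [labelTerm, ← h1]
  congr 2
  refine Finset.prod_congr rfl fun v _ => ?_
  rw [List.map_ofFn, vertexTensor_ofFn]
  rfl

theorem prod_units_smul {α : Type*} (t : Finset α) (u : α → ℤˣ) (x : α → k) :
    (∏ i ∈ t, u i) • ∏ i ∈ t, x i = ∏ i ∈ t, u i • x i := by
  simp only [Units.smul_def, zsmul_eq_mul, Finset.prod_mul_distrib, Units.coe_prod, Int.cast_prod]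

/-- Signs between different vertices depend only on the sets of half-edges, while the sign within a
vertex is compensated by the graded symmetry of its tensor. The equality holds for each labeling
separately. -/
theorem contraction_congr (hB : IsInvariantInnerProduct L B) (hb : ∀ i, b i ∈ 𝒲 (p i))
    {f : Fin m × Bool → Fin n} {ls ls' : Fin n → List (Fin m × Bool)} (h : IsFiberList f ls)
    (h' : IsFiberList f ls') : contraction L B b p ls = contraction L B b p ls' := by
  refine Finset.sum_congr rfl fun j _ => ?_
  have h1 : ∀ ls : Fin n → List (Fin m × Bool), labelTerm L B b p ls j =
      (∏ j', ∏ i ∈ Finset.Iio j', crossSign edgeOrder (p ∘ j) (ls i) (ls j')) •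
        ((∏ v, listSign edgeOrder (p ∘ j) (ls v) • vertexTensor L B b ((ls v).map j)) *
          ∏ e : Fin m, inverseGram B b (j (e, false)) (j (e, true))) := by
    intro ls
    rw [labelTerm, listSign_flatten_ofFn, mul_comm, ← smul_smul, ← smul_mul_assoc,
      prod_units_smul]
  rw [h1, h1]
  congr 1
  · exact Finset.prod_congr rfl fun _ _ => Finset.prod_congr rfl fun _ _ =>
      crossSign_perm (h.perm h' _) (h.perm h' _)
  · congr 1
    exact Finset.prod_congr rfl fun v _ => listSign_smul_vertexTensor_perm hB
      isTournament_edgeOrder hb j (h v).1 (h.perm h' v)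

/-- In a nonzero summand every vertex tensor is odd, so the blocks of half-edges anticommute. -/
theorem contraction_comp_perm (hB : IsInvariantInnerProduct L B) (hb : ∀ i, b i ∈ 𝒲 (p i))
    {f : Fin m × Bool → Fin n} {ls : Fin n → List (Fin m × Bool)} (h : IsFiberList f ls)
    (π : Equiv.Perm (Fin n)) :
    contraction L B b p (fun v => ls (π v)) =
      Equiv.Perm.sign π • contraction L B b p ls := by
  rw [contraction, contraction, Finset.smul_sum]
  refine Finset.sum_congr rfl fun j _ => ?_
  rw [labelTerm, labelTerm, Equiv.prod_comp π fun v => vertexTensor L B b ((ls v).map j)]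
  by_cases h0 : ∏ v, vertexTensor L B b ((ls v).map j) = 0
  · rw [h0, zero_mul, smul_zero, smul_zero, smul_zero]
  · rw [← ne_eq, Finset.prod_ne_zero_iff] at h0
    rw [listSign_flatten_perm isTournament_edgeOrder (fun v => ?_)
      (fun u v huv => h.disjoint huv) π, smul_smul]
    rw [← listParity_of_vertexTensor_ne_zero hB hb (h0 v (mem_univ v))]
    simp [listParity]

theorem halfEdgePerm_apply (π : Equiv.Perm (Fin m)) (ρ : Fin m → Bool) (e : Fin m) (x : Bool) :
    halfEdgePerm π ρ (e, x) = (π e, if ρ e then !x else x) := by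
  by_cases h : ρ e <;> simp [halfEdgePerm, Equiv.prodShear, h]

/-- The two halves of an edge have equal parity, so edges are even blocks and their permutation is
free. Only the exchange of the two halves of an odd edge costs a sign. -/
theorem koszulSign_halfEdgePerm (π : Equiv.Perm (Fin m)) (ρ : Fin m → Bool)
    {q : Fin m × Bool → ZMod 2} (hq : ∀ e, q (e, false) = q (e, true)) :
    koszulSign (fun x y => edgeOrder (halfEdgePerm π ρ x) (halfEdgePerm π ρ y)) edgeOrder
      (fun h => q h = 1) = ∏ e, if ρ e then paritySign (q (e, true)) else 1 := by
  classical
  unfold koszulSign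
  simp only [Fintype.prod_prod_type, Fintype.prod_bool, ← Finset.prod_mul_distrib]
  refine Finset.prod_congr rfl fun e _ => ?_
  rw [Finset.prod_eq_single e]
  · simp only [halfEdgePerm_apply, edgeOrder, lt_irrefl, hq, true_and, false_or]
    rcases zmod_two_cases (q (e, true)) with h | h <;> by_cases hρ : ρ e = true <;>
      simp [h, hρ, paritySign, (by decide : ¬ true < false)]
  -- For distinct edges the four pairs of half-edges contribute equal factors, whose product is one.
  · intro e' _ hne
    have h1 : π e ≠ π e' := fun h => hne (π.injective h).symm
    simp only [halfEdgePerm_apply, edgeOrder, h1, hne, hq, false_and, or_false]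
    split_ifs <;> simp
  · simp

/-- On an edge of parity `p`, reversal contributes `(-1)^p` to the Koszul sign and `-(-1)^p` through
the antisymmetry of the inverse matrix: together `-1`, whatever `p` is. -/
theorem contraction_map_halfEdgePerm [CharZero k] (hB : IsInvariantInnerProduct L B)
    (hb : ∀ i, b i ∈ 𝒲 (p i)) {f : Fin m × Bool → Fin n} {ls : Fin n → List (Fin m × Bool)}
    (h : IsFiberList f ls) (π : Equiv.Perm (Fin m)) (ρ : Fin m → Bool) :
    contraction L B b p (fun v => (ls v).map (halfEdgePerm π ρ)) =
      (∏ e, if ρ e then (-1 : ℤˣ) else 1) • contraction L B b p ls := by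
  rw [contraction, contraction, Finset.smul_sum]
  refine (Fintype.sum_equiv (Equiv.arrowCongr (halfEdgePerm π ρ) (Equiv.refl ι)) _ _
    fun j => ?_).symm
  have hφ : ∀ x, (Equiv.arrowCongr (halfEdgePerm π ρ) (Equiv.refl ι)) j (halfEdgePerm π ρ x) =
      j x := fun x => by simp
  set j' := (Equiv.arrowCongr (halfEdgePerm π ρ) (Equiv.refl ι)) j with hj'
  have hcomp : j' ∘ halfEdgePerm π ρ = j := funext hφ
  have hflat : (List.ofFn fun v => (ls v).map (halfEdgePerm π ρ)).flatten =
      (List.ofFn ls).flatten.map (halfEdgePerm π ρ) := by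
    rw [List.map_flatten, List.map_ofFn]; rfl
  have hv : ∀ v, ((ls v).map (halfEdgePerm π ρ)).map j' = (ls v).map j := fun v => by
    rw [List.map_map, hcomp]
  have hk : ∏ e, inverseGram B b (j' (e, false)) (j' (e, true)) =
      ∏ e, if ρ e then inverseGram B b (j (e, true)) (j (e, false)) else
        inverseGram B b (j (e, false)) (j (e, true)) := by
    rw [← Equiv.prod_comp π]
    refine Finset.prod_congr rfl fun e _ => ?_
    have h1 := hφ (e, false)
    have h2 := hφ (e, true)
    rw [halfEdgePerm_apply] at h1 h2
    by_cases hρ : ρ e = true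
    · simp only [hρ, if_true, Bool.not_false, Bool.not_true] at h1 h2 ⊢
      rw [h1, h2]
    · simp only [hρ, Bool.false_eq_true, if_false] at h1 h2 ⊢
      rw [h1, h2]
  rw [labelTerm, labelTerm, hflat, hk, listSign_map]
  simp only [hv]
  rw [show (p ∘ j') ∘ halfEdgePerm π ρ = p ∘ j by rw [Function.comp_assoc, hcomp]]
  -- Labelings with different parities on some edge contribute zero, because the edge tensor is
  -- even.
  by_cases hq : ∀ e, p (j (e, false)) = p (j (e, true))
  · have h1 := koszulSign_eq_listSign (q := p ∘ j)
      (isTournament_edgeOrder.comap (halfEdgePerm π ρ).injective) isTournament_edgeOrder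
      h.nodup_flatten h.mem_flatten
    rw [koszulSign_halfEdgePerm π ρ hq] at h1
    have h2 : (∏ e, if ρ e then inverseGram B b (j (e, true)) (j (e, false)) else
        inverseGram B b (j (e, false)) (j (e, true))) =
        (∏ e, if ρ e then -paritySign (p (j (e, true))) else 1) •
          ∏ e, inverseGram B b (j (e, false)) (j (e, true)) := by
      rw [prod_units_smul]
      refine Finset.prod_congr rfl fun e _ => ?_
      split_ifs
      · rw [inverseGram_antisymm hB hb, hq]
        have : ∀ a : ZMod 2, a * a = a := by decide
        rw [this, Units.smul_def, Units.smul_def, Units.val_neg, neg_smul]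
      · rw [one_smul]
    have h3 : listSign (fun x y => edgeOrder (halfEdgePerm π ρ x) (halfEdgePerm π ρ y)) (p ∘ j)
        (List.ofFn ls).flatten =
        (∏ e, if ρ e then paritySign ((p ∘ j) (e, true)) else 1) *
          listSign edgeOrder (p ∘ j) (List.ofFn ls).flatten := by
      rw [h1, mul_assoc, units_mul_self, mul_one]
    rw [h2, h3, mul_smul_comm, smul_smul, smul_smul]
    congr 1
    rw [mul_right_comm, ← Finset.prod_mul_distrib]
    congr 1
    refine Finset.prod_congr rfl fun e _ => ?_
    split_ifs
    · rw [Function.comp_apply, mul_neg, units_mul_self]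
    · rfl
  · push Not at hq
    obtain ⟨e, he⟩ := hq
    have h1 : ∏ e, inverseGram B b (j (e, false)) (j (e, true)) = 0 :=
      Finset.prod_eq_zero (mem_univ e) (inverseGram_even hB hb he)
    have h2 : (∏ e, if ρ e then inverseGram B b (j (e, true)) (j (e, false)) else
        inverseGram B b (j (e, false)) (j (e, true))) = 0 :=
      Finset.prod_eq_zero (mem_univ e) (by
        rw [inverseGram_even hB hb he, inverseGram_even hB hb he.symm, ite_self])
    rw [h1, h2]
    simp

/-- The contraction is invariant under isomorphisms of oriented graphs and changes its sign when the
orientation is reversed. -/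
theorem partitionNumber_relabel [CharZero k] (hB : IsInvariantInnerProduct L B)
    (hb : ∀ i, b i ∈ 𝒲 (p i)) (Γ : OrientedGraph n m) (g : Relabeling n m) (o : HalfEdgeOrder Γ)
    (o' : HalfEdgeOrder (relabel g Γ)) :
    partitionNumber L B b p (relabel g Γ) o' =
      orientationSign g • partitionNumber L B b p Γ o := by
  have h := isFiberList_halfEdgeOrder Γ o
  rw [partitionNumber_eq_contraction, partitionNumber_eq_contraction]
  set ls : Fin n → List (Fin m × Bool) := fun v => List.ofFn fun i => (o v i).1 with hls
  have h1 : IsFiberList (relabel g Γ).1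
      fun v => (ls (g.1⁻¹ v)).map (halfEdgePerm g.2.1 g.2.2) := by
    refine fun v => ⟨(h _).1.map (halfEdgePerm g.2.1 g.2.2).injective, fun x => ?_⟩
    change _ ↔ g.1 (Γ.1 ((halfEdgePerm g.2.1 g.2.2).symm x)) = v
    rw [List.mem_map, ← Equiv.Perm.eq_inv_iff_eq, ← (h _).2]
    constructor
    · rintro ⟨y, hy, rfl⟩
      simpa using hy
    · exact fun hx => ⟨_, hx, by simp⟩
  have h2 : IsFiberList (fun x => g.1 (Γ.1 x)) fun v => ls (g.1⁻¹ v) := fun v =>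
    ⟨(h _).1, fun x => by rw [(h _).2, Equiv.Perm.eq_inv_iff_eq]⟩
  rw [contraction_congr hB hb (isFiberList_halfEdgeOrder _ o') h1,
    contraction_map_halfEdgePerm hB hb h2, contraction_comp_perm hB hb h, smul_smul,
    Equiv.Perm.sign_inv, orientationSign, mul_comm]

end Contraction

/-! ### Composition of relabelings -/

section Relabeling

variable {n m : ℕ}

/-- The composition of two relabelings. -/
def relabelingMul (g h : Relabeling n m) : Relabeling n m :=
  (g.1 * h.1, g.2.1 * h.2.1, fun e => xor (h.2.2 e) (g.2.2 (h.2.1 e)))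

theorem halfEdgePerm_mul (g h : Relabeling n m) :
    halfEdgePerm (relabelingMul g h).2.1 (relabelingMul g h).2.2 =
      halfEdgePerm g.2.1 g.2.2 * halfEdgePerm h.2.1 h.2.2 := by
  ext1 ⟨e, x⟩
  rw [Equiv.Perm.mul_apply, halfEdgePerm_apply, halfEdgePerm_apply, halfEdgePerm_apply]
  simp only [relabelingMul, Equiv.Perm.mul_apply]
  by_cases h1 : h.2.2 e = true <;> by_cases h2 : g.2.2 (h.2.1 e) = true <;> simp [h1, h2]

theorem relabel_mul (g h : Relabeling n m) (Γ : OrientedGraph n m) :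
    relabel (relabelingMul g h) Γ = relabel g (relabel h Γ) := by
  apply Subtype.ext
  funext x
  change (g.1 * h.1) (Γ.1 ((halfEdgePerm _ _).symm x)) =
    g.1 (h.1 (Γ.1 ((halfEdgePerm _ _).symm ((halfEdgePerm _ _).symm x))))
  rw [halfEdgePerm_mul]
  rfl

theorem relabelingMul_left_bijective (g : Relabeling n m) :
    Function.Bijective (relabelingMul g) := by
  refine Finite.injective_iff_bijective.1 fun h h' hh => ?_
  obtain ⟨σ, π, ρ⟩ := h
  obtain ⟨σ', π', ρ'⟩ := h'
  simp only [relabelingMul, Prod.mk.injEq, mul_right_inj] at hh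
  obtain ⟨rfl, rfl, hρ⟩ := hh
  congr
  funext e
  simpa using congrFun hρ e

theorem relabelingMul_right_bijective (g : Relabeling n m) :
    Function.Bijective fun h => relabelingMul h g := by
  refine Finite.injective_iff_bijective.1 fun h h' hh => ?_
  obtain ⟨σ, π, ρ⟩ := h
  obtain ⟨σ', π', ρ'⟩ := h'
  simp only [relabelingMul, Prod.mk.injEq, mul_left_inj] at hh
  obtain ⟨rfl, rfl, hρ⟩ := hh
  congr
  funext e
  simpa using congrFun hρ (g.2.1.symm e)

theorem relabel_one (Γ : OrientedGraph n m) : relabel (1, 1, fun _ => false) Γ = Γ := by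
  apply Subtype.ext
  funext x
  change Γ.1 ((halfEdgePerm _ _).symm x) = Γ.1 x
  have : x = halfEdgePerm 1 (fun _ => false) x := by
    obtain ⟨e, y⟩ := x
    simp [halfEdgePerm_apply]
  exact congrArg Γ.1 ((Equiv.symm_apply_eq _).2 this)

theorem exists_relabel_inv (g : Relabeling n m) :
    ∃ h : Relabeling n m, ∀ Γ, relabel h (relabel g Γ) = Γ := by
  obtain ⟨h, hh⟩ := (relabelingMul_right_bijective g).2 (1, 1, fun _ => false)
  exact ⟨h, fun Γ => (relabel_mul h g Γ).symm.trans ((congrArg (relabel · Γ) hh).trans (relabel_one Γ))⟩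

theorem Isomorphic.symm {Γ Γ' : OrientedGraph n m} (h : Isomorphic Γ Γ') : Isomorphic Γ' Γ := by
  obtain ⟨g, rfl⟩ := h
  obtain ⟨h, hh⟩ := exists_relabel_inv g
  exact ⟨h, hh Γ⟩

theorem relabel_bijective (g : Relabeling n m) :
    Function.Bijective (relabel g : OrientedGraph n m → OrientedGraph n m) := by
  obtain ⟨h, hh⟩ := exists_relabel_inv g
  exact Finite.injective_iff_bijective.1 (Function.LeftInverse.injective hh)

/-- These relabelings form a coset of the automorphism group. -/
theorem card_relabelings_to (g : Relabeling n m) (Γ : OrientedGraph n m) :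
    Nat.card {h : Relabeling n m // relabel h Γ = relabel g Γ} = autCount Γ :=
  (Nat.card_congr ((Equiv.ofBijective _ (relabelingMul_left_bijective g)).subtypeEquiv fun h => by
    rw [Equiv.ofBijective_apply, relabel_mul, (relabel_bijective g).1.eq_iff])).symm

theorem autCount_relabel (g : Relabeling n m) (Γ : OrientedGraph n m) :
    autCount (relabel g Γ) = autCount Γ := by
  rw [← card_relabelings_to g Γ]
  exact Nat.card_congr ((Equiv.ofBijective _ (relabelingMul_right_bijective g)).subtypeEquiv
    fun h => by rw [Equiv.ofBijective_apply, relabel_mul])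

theorem autCount_ne_zero (Γ : OrientedGraph n m) : autCount Γ ≠ 0 := by
  have : Nonempty {g : Relabeling n m // relabel g Γ = Γ} := ⟨⟨_, relabel_one Γ⟩⟩
  exact Nat.card_pos.ne'

/-- Orbit-stabilizer for the relabelings acting on oriented graphs. -/
theorem card_isomorphic_mul_autCount (Γ : OrientedGraph n m) :
    (open Classical in #{Γ' | Isomorphic Γ' Γ}) * autCount Γ =
      Fintype.card (Relabeling n m) := by
  classical
  rw [← Finset.card_univ, Finset.card_eq_sum_card_fiberwise (f := fun g => relabel g Γ)
    (t := {Γ' | Isomorphic Γ' Γ}) (fun g _ => by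
      rw [Finset.mem_coe, Finset.mem_filter]
      exact ⟨mem_univ _, Isomorphic.symm ⟨g, rfl⟩⟩),
    ← smul_eq_mul, ← Finset.sum_const]
  refine Finset.sum_congr rfl fun Γ' hΓ' => ?_
  obtain ⟨g, rfl⟩ := Isomorphic.symm (Finset.mem_filter.1 hΓ').2
  rw [← card_relabelings_to g Γ, Nat.card_eq_fintype_card, Fintype.card_subtype]

end Relabeling

/-! ### The chain as a sum over all oriented graphs -/

section Chain

variable {k W : Type*} [Field k] [AddCommGroup W] [Module k W]
  {𝒲 : ZMod 2 → Submodule k W} {ι : Type*} [Fintype ι] [DecidableEq ι] {n m : ℕ}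

/-- The contraction attached to a map from the half-edges to the vertices. -/
noncomputable def graphNumber (L : LInfinityAlgebra k 𝒲)
    (B : LinearMap.BilinForm k W) (b : Module.Basis ι k W) (p : ι → ZMod 2)
    (f : Fin m × Bool → Fin n) : k :=
  contraction L B b p (fiberList f)

variable {L : LInfinityAlgebra k 𝒲} {B : LinearMap.BilinForm k W} {b : Module.Basis ι k W}
  {p : ι → ZMod 2}

theorem partitionNumber_eq_graphNumber (hB : IsInvariantInnerProduct L B)
    (hb : ∀ i, b i ∈ 𝒲 (p i)) (Γ : OrientedGraph n m) (o : HalfEdgeOrder Γ) :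
    partitionNumber L B b p Γ o = graphNumber L B b p Γ.1 := by
  rw [partitionNumber_eq_contraction]
  exact contraction_congr hB hb (isFiberList_halfEdgeOrder Γ o) (isFiberList_fiberList _)

theorem nonempty_halfEdgeOrder (Γ : OrientedGraph n m) : Nonempty (HalfEdgeOrder Γ) :=
  ⟨fun _ => (Fintype.equivFin _).symm⟩

theorem graphNumber_relabel [CharZero k] (hB : IsInvariantInnerProduct L B)
    (hb : ∀ i, b i ∈ 𝒲 (p i)) (g : Relabeling n m) (Γ : OrientedGraph n m) :
    graphNumber L B b p (relabel g Γ).1 = orientationSign g • graphNumber L B b p Γ.1 := by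
  obtain ⟨o⟩ := nonempty_halfEdgeOrder Γ
  obtain ⟨o'⟩ := nonempty_halfEdgeOrder (relabel g Γ)
  rw [← partitionNumber_eq_graphNumber hB hb _ o, ← partitionNumber_eq_graphNumber hB hb _ o',
    partitionNumber_relabel hB hb]

theorem smul_smul_units {M : Type*} [AddCommGroup M] [Module k M] (u : ℤˣ) (a : k) (x : M) :
    (u • a) • (u • x) = a • x := by
  simp only [Units.smul_def]
  rw [smul_assoc, smul_comm a, smul_smul, ← Units.val_mul, units_mul_self, Units.val_one, one_smul]

/-- Both factors change by the same orientation sign, whose square is one. -/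
theorem graphNumber_smul_graphClass_relabel [CharZero k] (hB : IsInvariantInnerProduct L B)
    (hb : ∀ i, b i ∈ 𝒲 (p i)) {Γ Γ' : OrientedGraph n m} (h : Isomorphic Γ Γ') :
    graphNumber L B b p Γ.1 • graphClass k Γ = graphNumber L B b p Γ'.1 • graphClass k Γ' := by
  obtain ⟨g, rfl⟩ := h
  rw [graphNumber_relabel hB hb, graphClass_relabel, smul_smul_units]

theorem graphChain_eq (hB : IsInvariantInnerProduct L B) (hb : ∀ i, b i ∈ 𝒲 (p i))
    (R : Finset (OrientedGraph n m)) (o : ∀ Γ : OrientedGraph n m, HalfEdgeOrder Γ) :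
    graphChain L B b p R o = ∑ Γ ∈ R,
      (autCount Γ : k)⁻¹ • graphNumber L B b p Γ.1 • graphClass k Γ :=
  Finset.sum_congr rfl fun Γ _ => by
    rw [partitionNumber_eq_graphNumber hB hb, smul_smul, div_eq_inv_mul]

theorem graphChain_eq_of_isRepresentatives [CharZero k] (hB : IsInvariantInnerProduct L B)
    (hb : ∀ i, b i ∈ 𝒲 (p i)) {P : OrientedGraph n m → Prop} {R R' : Finset (OrientedGraph n m)}
    (o o' : ∀ Γ : OrientedGraph n m, HalfEdgeOrder Γ) (hR : IsRepresentatives P R)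
    (hR' : IsRepresentatives P R') : graphChain L B b p R o = graphChain L B b p R' o' := by
  classical
  rw [graphChain_eq hB hb, graphChain_eq hB hb]
  set d : OrientedGraph n m → Chains k n m := fun Γ =>
    (autCount Γ : k)⁻¹ • graphNumber L B b p Γ.1 • graphClass k Γ with hd
  have hiso : ∀ {Γ Γ'}, Isomorphic Γ Γ' → d Γ = d Γ' := by
    intro Γ Γ' h
    have h1 := graphNumber_smul_graphClass_relabel hB hb h
    obtain ⟨g, rfl⟩ := h
    rw [hd]
    simp only
    rw [h1, autCount_relabel]
  change ∑ Γ ∈ R, d Γ = ∑ Γ ∈ R', d Γ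
  -- Each representative in one set is isomorphic to exactly one in the other, so both chains equal
  -- a sum over the isomorphic pairs in `R × R'`.
  have key : ∀ {R R' : Finset (OrientedGraph n m)}, IsRepresentatives P R →
      IsRepresentatives P R' → ∀ Γ ∈ R, d Γ = ∑ Γ' ∈ R', if Isomorphic Γ Γ' then d Γ' else 0 := by
    intro R R' hR hR' Γ hΓ
    obtain ⟨Γ', ⟨hΓ', hi⟩, hu⟩ := hR'.2 Γ (hR.1 Γ hΓ)
    rw [Finset.sum_eq_single Γ', if_pos hi, hiso hi]
    · exact fun Γ'' h hne => if_neg fun hi' => hne (hu Γ'' ⟨h, hi'⟩)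
    · exact fun h => absurd hΓ' h
  rw [Finset.sum_congr rfl (key hR hR'), Finset.sum_comm, Finset.sum_congr rfl (key hR' hR)]
  refine Finset.sum_congr rfl fun Γ' _ => Finset.sum_congr rfl fun Γ _ => ?_
  by_cases h : Isomorphic Γ Γ'
  · rw [if_pos h, if_pos h.symm, hiso h]
  · rw [if_neg h, if_neg fun h' => h h'.symm]

/-- A class has `|Relabeling| / |Aut Γ|` members, all with the same value of `Z(Γ) Γ`. The weights
`1/|Aut Γ|` are thus traded for a sum over all oriented graphs. -/
theorem card_smul_graphChain [CharZero k] (hB : IsInvariantInnerProduct L B)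
    (hb : ∀ i, b i ∈ 𝒲 (p i)) {P : OrientedGraph n m → Prop} {R : Finset (OrientedGraph n m)}
    (hP : ∀ g Γ, P (relabel g Γ) ↔ P Γ) (o : ∀ Γ : OrientedGraph n m, HalfEdgeOrder Γ)
    (hR : IsRepresentatives P R) :
    (Fintype.card (Relabeling n m) : k) • graphChain L B b p R o =
      ∑ Γ ∈ (open Classical in univ.filter P), graphNumber L B b p Γ.1 • graphClass k Γ := by
  classical
  rw [graphChain_eq hB hb, Finset.smul_sum]
  set c : OrientedGraph n m → Chains k n m := fun Γ => graphNumber L B b p Γ.1 • graphClass k Γ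
  have key : ∀ Γ ∈ univ.filter P, c Γ = ∑ Γ' ∈ R, if Isomorphic Γ Γ' then c Γ' else 0 := by
    intro Γ hΓ
    obtain ⟨Γ', ⟨hΓ', hi⟩, hu⟩ := hR.2 Γ (Finset.mem_filter.1 hΓ).2
    rw [Finset.sum_eq_single Γ', if_pos hi]
    · exact graphNumber_smul_graphClass_relabel hB hb hi
    · exact fun Γ'' h hne => if_neg fun hi' => hne (hu Γ'' ⟨h, hi'⟩)
    · exact fun h => absurd hΓ' h
  rw [Finset.sum_congr rfl key, Finset.sum_comm]
  refine Finset.sum_congr rfl fun Γ hΓ => ?_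
  have h1 : univ.filter (fun Γ' => P Γ' ∧ Isomorphic Γ' Γ) = univ.filter (Isomorphic · Γ) := by
    ext Γ'
    simp only [mem_filter, mem_univ, true_and, and_iff_right_iff_imp]
    intro h
    obtain ⟨g, rfl⟩ := h.symm
    exact (hP g Γ).2 (hR.1 Γ hΓ)
  rw [← Finset.sum_filter, Finset.filter_filter, h1, Finset.sum_const,
    ← card_isomorphic_mul_autCount Γ, smul_smul, Nat.cast_mul, mul_assoc,
    mul_inv_cancel₀ (Nat.cast_ne_zero.2 (autCount_ne_zero Γ)), mul_one, Nat.cast_smul_eq_nsmul]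

end Chain

/-! ### Unshuffles and subsets -/

theorem mem_unshuffles {a n : ℕ} {σ : Equiv.Perm (Fin n)} : σ ∈ unshuffles a n ↔
    (∀ i j : Fin n, i < j → j.val < a → σ i < σ j) ∧
      (∀ i j : Fin n, i < j → a ≤ i.val → σ i < σ j) := by
  simp [unshuffles]

/-- The image of the first `a` letters. -/
def firstImage {n : ℕ} (a : ℕ) (σ : Equiv.Perm (Fin n)) : Finset (Fin n) :=
  (univ.filter fun i : Fin n => i.val < a).image σ

theorem mem_firstImage {n a : ℕ} {σ : Equiv.Perm (Fin n)} {i : Fin n} :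
    σ i ∈ firstImage a σ ↔ i.val < a := by
  simp [firstImage]

theorem card_firstImage {n a : ℕ} (ha : a ≤ n) (σ : Equiv.Perm (Fin n)) :
    #(firstImage a σ) = a := by
  rw [firstImage, Finset.card_image_of_injective _ σ.injective]
  simp [Fin.card_filter_val_lt, ha]

/-- An unshuffle lists a set and then its complement, each in its unique increasing order. -/
theorem unshuffle_eq_of_firstImage_eq {n a : ℕ} (ha : a ≤ n) {σ τ : Equiv.Perm (Fin n)}
    (hσ : σ ∈ unshuffles a n) (hτ : τ ∈ unshuffles a n) (h : firstImage a σ = firstImage a τ) :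
    σ = τ := by
  rw [mem_unshuffles] at hσ hτ
  ext1 i
  by_cases hi : i.val < a
  · have key : ∀ ρ : Equiv.Perm (Fin n), (∀ i j : Fin n, i < j → j.val < a → ρ i < ρ j) →
        firstImage a ρ = firstImage a σ → (fun i : Fin a => ρ (Fin.castLE ha i)) =
          (firstImage a σ).orderEmbOfFin (card_firstImage ha σ) := fun ρ hρ he =>
      Finset.orderEmbOfFin_unique _ (fun x => by rw [← he, mem_firstImage]; exact x.2)
        fun x y hxy => hρ _ _ hxy y.2
    exact congrFun ((key σ hσ.1 rfl).trans (key τ hτ.1 h.symm).symm) ⟨i, hi⟩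
  · have hc : #(firstImage a σ)ᶜ = n - a := by
      rw [Finset.card_compl, card_firstImage ha, Fintype.card_fin]
    have key : ∀ ρ : Equiv.Perm (Fin n), (∀ i j : Fin n, i < j → a ≤ i.val → ρ i < ρ j) →
        firstImage a ρ = firstImage a σ → (fun i : Fin (n - a) => ρ ⟨a + i.val, by omega⟩) =
          ((firstImage a σ)ᶜ).orderEmbOfFin hc := fun ρ hρ he =>
      Finset.orderEmbOfFin_unique _
        (fun x => by
          rw [Finset.mem_compl, ← he, mem_firstImage]
          simp)
        fun x y hxy => hρ _ _ (Fin.mk_lt_mk.2 (Nat.add_lt_add_left hxy a)) (Nat.le_add_right _ _)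
    have := congrFun ((key σ hσ.2 rfl).trans (key τ hτ.2 h.symm).symm) ⟨i - a, by omega⟩
    have hi' : (⟨a + (i.val - a), by omega⟩ : Fin n) = i := Fin.ext (by simp; omega)
    simpa [hi'] using this

theorem exists_unshuffle {n a : ℕ} (S : Finset (Fin n)) (hS : #S = a) :
    ∃ σ ∈ unshuffles a n, firstImage a σ = S := by
  have ha : a ≤ n := hS ▸ card_finset_fin_le S
  have hc : #Sᶜ = n - a := by rw [Finset.card_compl, hS, Fintype.card_fin]
  let σ : Equiv.Perm (Fin n) := (finCongr (by omega : n = a + (n - a))).trans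
    (finSumFinEquiv.symm.trans (finSumEquivOfFinset hS hc))
  have h1 : ∀ (i : Fin n) (hi : i.val < a), σ i = S.orderEmbOfFin hS ⟨i, hi⟩ := by
    intro i hi
    have : finCongr (by omega : n = a + (n - a)) i = Fin.castAdd _ ⟨i, hi⟩ := Fin.ext rfl
    simp only [σ, Equiv.trans_apply, this, finSumFinEquiv_symm_apply_castAdd,
      finSumEquivOfFinset_inl]
  have h2 : ∀ (i : Fin n) (hi : a ≤ i.val),
      σ i = (Sᶜ).orderEmbOfFin hc ⟨i - a, by omega⟩ := by
    intro i hi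
    have : finCongr (by omega : n = a + (n - a)) i = Fin.natAdd a ⟨i - a, by omega⟩ :=
      Fin.ext (by simp; omega)
    simp only [σ, Equiv.trans_apply, this, finSumFinEquiv_symm_apply_natAdd,
      finSumEquivOfFinset_inr]
  refine ⟨σ, mem_unshuffles.2 ⟨fun i j hij hj => ?_, fun i j hij hi => ?_⟩, ?_⟩
  · rw [h1 i (lt_trans hij hj), h1 j hj]
    exact (S.orderEmbOfFin hS).strictMono hij
  · rw [h2 i hi, h2 j (hi.trans hij.le)]
    refine ((Sᶜ).orderEmbOfFin hc).strictMono ?_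
    rw [Fin.mk_lt_mk]
    have : i.val < j.val := hij
    omega
  · refine Finset.eq_of_subset_of_card_le (fun x hx => ?_) (by rw [card_firstImage ha, hS])
    obtain ⟨i, hi, rfl⟩ := Finset.mem_image.1 hx
    rw [h1 i (Finset.mem_filter.1 hi).2]
    exact Finset.orderEmbOfFin_mem _ _ _

theorem sum_unshuffles {M : Type*} [AddCommMonoid M] {n a : ℕ} (ha : a ≤ n)
    (F : Finset (Fin n) → M) :
    ∑ σ ∈ unshuffles a n, F (firstImage a σ) = ∑ S ∈ powersetCard a univ, F S :=
  Finset.sum_bij (fun σ _ => firstImage a σ)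
    (fun σ _ => Finset.mem_powersetCard.2 ⟨subset_univ _, card_firstImage ha σ⟩)
    (fun _ hσ _ hτ h => unshuffle_eq_of_firstImage_eq ha hσ hτ h)
    (fun S hS => by
      obtain ⟨σ, hσ, h⟩ := exists_unshuffle S (Finset.mem_powersetCard.1 hS).2
      exact ⟨σ, hσ, h⟩)
    fun _ _ => rfl

/-- The unshuffles with at least one letter in the first part correspond to the nonempty sets. -/
theorem sum_unshuffles_eq_sum_finset {M : Type*} [AddCommMonoid M] {N : ℕ}
    (F : Finset (Fin (N + 1)) → M) (h0 : F ∅ = 0) :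
    ∑ a : Fin (N + 1), ∑ σ ∈ unshuffles (a.val + 1) (N + 1), F (firstImage (a.val + 1) σ) =
      ∑ S, F S := by
  have h1 : ∀ a : Fin (N + 1), ∑ σ ∈ unshuffles (a.val + 1) (N + 1),
      F (firstImage (a.val + 1) σ) = ∑ S ∈ powersetCard (a.val + 1) univ, F S := fun a =>
    sum_unshuffles (by omega) F
  rw [Finset.sum_congr rfl fun a _ => h1 a,
    Fin.sum_univ_eq_sum_range fun a => ∑ S ∈ powersetCard (a + 1) univ, F S,
    ← Finset.powerset_univ, Finset.sum_powerset, Finset.card_univ, Fintype.card_fin,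
    Finset.sum_range_succ' _ (N + 1)]
  simp [h0]

/-! ### Splitting a vertex -/

section Split

variable {n m : ℕ}

/-- The inclusion of the half-edges which avoids the first edge. -/
def succHalfEdge (x : Fin m × Bool) : Fin (m + 1) × Bool := (x.1.succ, x.2)

theorem succHalfEdge_injective : Function.Injective (succHalfEdge (m := m)) := fun x y h => by
  simp only [succHalfEdge, Prod.mk.injEq, Fin.succ_inj] at h
  exact Prod.ext h.1 h.2

theorem edgeOrder_succHalfEdge (x y : Fin m × Bool) :
    edgeOrder (succHalfEdge x) (succHalfEdge y) ↔ edgeOrder x y := by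
  simp [edgeOrder, succHalfEdge]

/-- The graph obtained from `f` by splitting the vertex `0` into the vertices `0` and `1`, joined by
a new edge `0`: the half-edges in `A` stay at `0`, the others move to `1`. -/
noncomputable def splitMap (f : Fin m × Bool → Fin (n + 1)) (A : Set (Fin m × Bool))
    (h : Fin (m + 1) × Bool) : Fin (n + 2) :=
  open Classical in
  Fin.cases (motive := fun _ => Fin (n + 2)) (if h.2 then 1 else 0)
    (fun e => if f (e, h.2) = 0 then (if (e, h.2) ∈ A then 0 else 1) else (f (e, h.2)).succ) h.1

theorem splitMap_zero (f : Fin m × Bool → Fin (n + 1)) (A : Set (Fin m × Bool)) (x : Bool) :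
    splitMap f A (0, x) = if x then 1 else 0 := rfl

open Classical in
theorem splitMap_succHalfEdge (f : Fin m × Bool → Fin (n + 1)) (A : Set (Fin m × Bool))
    (x : Fin m × Bool) : splitMap f A (succHalfEdge x) =
      if f x = 0 then (if x ∈ A then 0 else 1) else (f x).succ := rfl

/-- The lists of half-edges of the graph obtained by splitting a vertex. -/
def splitLists (A₀ A₁ : List (Fin m × Bool)) (R : Fin n → List (Fin m × Bool)) :
    Fin (n + 2) → List (Fin (m + 1) × Bool) :=
  Fin.cons (A₀.map succHalfEdge ++ [(0, false)])
    (Fin.cons ((0, true) :: A₁.map succHalfEdge) fun v => (R v).map succHalfEdge)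

theorem zero_notMem_map_succHalfEdge (l : List (Fin m × Bool)) (x : Bool) :
    ((0, x) : Fin (m + 1) × Bool) ∉ l.map succHalfEdge := by
  simp [succHalfEdge]

theorem forall_halfEdge {P : Fin (m + 1) × Bool → Prop} (h0 : ∀ x, P (0, x))
    (hs : ∀ x, P (succHalfEdge x)) (h : Fin (m + 1) × Bool) : P h := by
  obtain ⟨e, x⟩ := h
  revert x
  refine Fin.cases h0 (fun e => ?_) e
  exact fun x => hs (e, x)

theorem isFiberList_splitLists {f : Fin m × Bool → Fin (n + 1)} {A : Set (Fin m × Bool)}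
    {A₀ A₁ : List (Fin m × Bool)} {R : Fin n → List (Fin m × Bool)}
    (h0 : A₀.Nodup) (h0' : ∀ x, x ∈ A₀ ↔ f x = 0 ∧ x ∈ A)
    (h1 : A₁.Nodup) (h1' : ∀ x, x ∈ A₁ ↔ f x = 0 ∧ x ∉ A)
    (hR : ∀ v, (R v).Nodup ∧ ∀ x, x ∈ R v ↔ f x = v.succ) :
    IsFiberList (splitMap f A) (splitLists A₀ A₁ R) := by
  have hmem : ∀ (l : List (Fin m × Bool)) x, succHalfEdge x ∈ l.map succHalfEdge ↔ x ∈ l :=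
    fun l x => List.mem_map_of_injective succHalfEdge_injective
  have hne : ∀ (x : Fin m × Bool) c, succHalfEdge x ≠ (0, c) := fun x c h =>
    Fin.succ_ne_zero _ (congrArg Prod.fst h)
  have hz := zero_notMem_map_succHalfEdge (m := m)
  have hone : ∀ y : Fin (n + 1), y.succ = 1 ↔ y = 0 := fun y => by
    rw [← Fin.succ_zero_eq_one, Fin.succ_inj]
  have hone' : ∀ y : Fin n, (1 : Fin (n + 2)) ≠ y.succ.succ := fun y h =>
    Fin.succ_ne_zero y ((hone _).1 h.symm)
  intro v
  refine Fin.cases ?_ (fun v => Fin.cases ?_ (fun v => ?_) v) v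
  · refine ⟨?_, forall_halfEdge (fun x => ?_) fun x => ?_⟩
    · simp only [splitLists, Fin.cons_zero]
      rw [List.nodup_append]
      refine ⟨h0.map succHalfEdge_injective, by simp, ?_⟩
      rintro a ha c hc rfl
      rw [List.mem_singleton.1 hc] at ha
      exact hz _ _ ha
    · simp only [splitLists, Fin.cons_zero, List.mem_append, hz, splitMap_zero]
      cases x <;> simp
    · simp only [splitLists, Fin.cons_zero, List.mem_append, hmem, List.mem_singleton, hne,
        or_false, splitMap_succHalfEdge, h0']
      split_ifs with h2 h3 <;> simp [*]
  · refine ⟨?_, forall_halfEdge (fun x => ?_) fun x => ?_⟩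
    · simp only [splitLists, Fin.cons_zero, Fin.cons_succ, List.nodup_cons]
      exact ⟨hz _ _, h1.map succHalfEdge_injective⟩
    · simp only [splitLists, Fin.cons_zero, Fin.cons_succ, List.mem_cons, hz, splitMap_zero]
      cases x <;> simp
    · simp only [splitLists, Fin.cons_zero, Fin.cons_succ, List.mem_cons, hmem, hne,
        false_or, splitMap_succHalfEdge, h1']
      split_ifs with h2 h3
      · simp [h2, h3]
      · simp [h2, h3]
      · simp [h2, hone]
  · refine ⟨?_, forall_halfEdge (fun x => ?_) fun x => ?_⟩
    · simp only [splitLists, Fin.cons_succ]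
      exact (hR v).1.map succHalfEdge_injective
    · simp only [splitLists, Fin.cons_succ, hz, splitMap_zero, false_iff]
      cases x
      · simp [eq_comm]
      · simp only [if_true]
        exact hone' v
    · simp only [splitLists, Fin.cons_succ, hmem, splitMap_succHalfEdge, (hR v).2]
      split_ifs with h2 h3
      · simp [h2, eq_comm]
      · simp only [h2]
        refine iff_of_false (fun h => Fin.succ_ne_zero v h.symm) (hone' v)
      · rw [Fin.succ_inj]

/-- A labeling of the half-edges is a labeling of the first edge and of the others. -/
def labelingEquiv (ι : Type*) :
    (Fin (m + 1) × Bool → ι) ≃ (ι × ι) × (Fin m × Bool → ι) where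
  toFun j := ((j (0, false), j (0, true)), fun x => j (succHalfEdge x))
  invFun x h := Fin.cases (motive := fun _ => ι) (if h.2 then x.1.2 else x.1.1)
    (fun e => x.2 (e, h.2)) h.1
  left_inv j := by
    funext h
    revert h
    exact forall_halfEdge (fun x => by cases x <;> rfl) fun x => rfl
  right_inv x := rfl

end Split

/-! ### The L-infinity relation at a split vertex -/

section SplitContraction

variable {k W : Type*} [Field k] [AddCommGroup W] [Module k W] {𝒲 : ZMod 2 → Submodule k W}
  {ι : Type*} [Fintype ι] [DecidableEq ι] {n m : ℕ}
  {L : LInfinityAlgebra k 𝒲} {B : LinearMap.BilinForm k W} {b : Module.Basis ι k W}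
  {p : ι → ZMod 2}

/-- The new tail ends the list at vertex `0` and the new head begins the list at vertex `1`. The two
are neighbours in the whole list as well as in `edgeOrder`, so for equal parities they drop out of
the sign. -/
theorem labelTerm_splitLists [CharZero k] (hB : IsInvariantInnerProduct L B)
    (hb : ∀ i, b i ∈ 𝒲 (p i)) (A₀ A₁ : List (Fin m × Bool)) (R : Fin n → List (Fin m × Bool))
    (j : Fin (m + 1) × Bool → ι) (j' : Fin m × Bool → ι) (hj : ∀ x, j (succHalfEdge x) = j' x) :
    labelTerm L B b p (splitLists A₀ A₁ R) j =
      listSign edgeOrder (p ∘ j') (A₀ ++ (A₁ ++ (List.ofFn R).flatten)) •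
        ((vertexTensor L B b (A₀.map j' ++ [j (0, false)]) *
            inverseGram B b (j (0, false)) (j (0, true)) *
            vertexTensor L B b (j (0, true) :: A₁.map j')) *
          ((∏ v, vertexTensor L B b ((R v).map j')) *
            ∏ e : Fin m, inverseGram B b (j' (e, false)) (j' (e, true)))) := by
  have hcomp : j ∘ succHalfEdge = j' := funext hj
  have hmap : ∀ l : List (Fin m × Bool), (l.map succHalfEdge).map j = l.map j' := fun l => by
    rw [List.map_map, hcomp]
  have hflat : (List.ofFn (splitLists A₀ A₁ R)).flatten = A₀.map succHalfEdge ++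
      (0, false) :: (0, true) :: (A₁ ++ (List.ofFn R).flatten).map succHalfEdge := by
    rw [List.ofFn_succ, List.ofFn_succ]
    simp only [splitLists, Fin.cons_zero, Fin.cons_succ, List.flatten_cons, List.map_append,
      List.map_flatten, List.map_ofFn]
    simp [Function.comp_def]
  have hk : ∏ e : Fin (m + 1), inverseGram B b (j (e, false)) (j (e, true)) =
      inverseGram B b (j (0, false)) (j (0, true)) *
        ∏ e : Fin m, inverseGram B b (j' (e, false)) (j' (e, true)) := by
    rw [Fin.prod_univ_succ]
    congr 1
    refine Finset.prod_congr rfl fun e _ => ?_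
    rw [← hj, ← hj]
    rfl
  have hv : ∏ v, vertexTensor L B b ((splitLists A₀ A₁ R v).map j) =
      vertexTensor L B b (A₀.map j' ++ [j (0, false)]) *
        (vertexTensor L B b (j (0, true) :: A₁.map j') *
          ∏ v, vertexTensor L B b ((R v).map j')) := by
    rw [Fin.prod_univ_succ, Fin.prod_univ_succ]
    simp only [splitLists, Fin.cons_zero, Fin.cons_succ, List.map_append, List.map_cons, hmap,
      List.map_nil]
  rw [labelTerm, hv, hk]
  by_cases hq : p (j (0, false)) = p (j (0, true))
  · have hq' : (p ∘ j) (0, false) = (p ∘ j) (0, true) := hq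
    have hsign : listSign edgeOrder (p ∘ j) (List.ofFn (splitLists A₀ A₁ R)).flatten =
        listSign edgeOrder (p ∘ j') (A₀ ++ (A₁ ++ (List.ofFn R).flatten)) := by
      have hmem : ∀ z, z ∈ A₀.map (succHalfEdge (m := m)) ∨
          z ∈ (A₁ ++ (List.ofFn R).flatten).map succHalfEdge → ∃ x, z = succHalfEdge x := by
        rintro z (hz | hz) <;> obtain ⟨x, -, rfl⟩ := List.mem_map.1 hz <;> exact ⟨x, rfl⟩
      rw [hflat, listSign_remove_pair _ _ hq' (by simp [edgeOrder]) fun z hz => by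
          obtain ⟨x, rfl⟩ := hmem z hz
          simp [edgeOrder, succHalfEdge],
        ← List.map_append, listSign_map, Function.comp_assoc, hcomp]
      congr 1
      funext x y
      exact propext (edgeOrder_succHalfEdge x y)
    rw [hsign]
    congr 1
    ring
  · rw [inverseGram_even hB hb hq]
    simp

theorem contraction_splitLists [CharZero k] (hB : IsInvariantInnerProduct L B)
    (hb : ∀ i, b i ∈ 𝒲 (p i)) (A₀ A₁ : List (Fin m × Bool)) (R : Fin n → List (Fin m × Bool)) :
    contraction L B b p (splitLists A₀ A₁ R) = ∑ j : Fin m × Bool → ι,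
      (listSign edgeOrder (p ∘ j) (A₀ ++ (A₁ ++ (List.ofFn R).flatten)) •
        ∑ c, ∑ e, vertexTensor L B b (A₀.map j ++ [e]) * inverseGram B b e c *
          vertexTensor L B b (c :: A₁.map j)) *
        ((∏ v, vertexTensor L B b ((R v).map j)) *
          ∏ e : Fin m, inverseGram B b (j (e, false)) (j (e, true))) := by
  rw [contraction, ← (labelingEquiv ι).symm.sum_comp, Fintype.sum_prod_type_right]
  refine Finset.sum_congr rfl fun j _ => ?_
  rw [Fintype.sum_prod_type_right, Finset.smul_sum, Finset.sum_mul]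
  refine Finset.sum_congr rfl fun c _ => ?_
  rw [Finset.smul_sum, Finset.sum_mul]
  refine Finset.sum_congr rfl fun e _ => ?_
  rw [labelTerm_splitLists hB hb A₀ A₁ R _ j fun x => rfl, smul_mul_assoc]
  rfl

theorem ofFn_eq_append {α : Type*} {K M N : ℕ} (h : K + M = N) (g : Fin N → α) :
    List.ofFn g = (List.ofFn fun i : Fin K => g ⟨i.val, by omega⟩) ++
      List.ofFn fun i : Fin M => g ⟨K + i.val, by omega⟩ := by
  subst h
  rw [List.ofFn_add]
  rfl

/-- The L-infinity relation at a vertex of a graph: the sum of the contractions over the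
unshuffles of all the half-edges at the vertex but the last. -/
theorem sum_unshuffles_contraction [CharZero k] (hB : IsInvariantInnerProduct L B)
    (hb : ∀ i, b i ∈ 𝒲 (p i)) {N : ℕ} {t : Fin (N + 1) → Fin m × Bool}
    (ht : Function.Injective t) (y : Fin m × Bool) (R : Fin n → List (Fin m × Bool)) :
    ∑ a : Fin (N + 1), ∑ σ ∈ unshuffles (a.val + 1) (N + 1), contraction L B b p
      (splitLists (List.ofFn fun i : Fin (a.val + 1) => t (σ ⟨i.val, by omega⟩))
        ((List.ofFn fun i : Fin (N - a.val) => t (σ ⟨a.val + 1 + i.val, by omega⟩)) ++ [y])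
        R) = 0 := by
  simp only [contraction_splitLists hB hb]
  rw [Finset.sum_congr rfl fun a _ => Finset.sum_comm, Finset.sum_comm]
  refine Finset.sum_eq_zero fun j _ => ?_
  set X := ((∏ v, vertexTensor L B b ((R v).map j)) *
    ∏ e : Fin m, inverseGram B b (j (e, false)) (j (e, true)))
  have key := sum_unshuffles_vertexTensor (b := b) hB hb N (fun i => j (t i)) (j y)
  set Q := [y] ++ (List.ofFn R).flatten with hQ
  -- The two parts of the unshuffle form the permuted list `t ∘ σ`. The sign is therefore that of
  -- the relation times a factor independent of `a` and `σ`.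
  have hsign : ∀ (a : Fin (N + 1)) (σ : Equiv.Perm (Fin (N + 1))), listSign edgeOrder (p ∘ j)
      ((List.ofFn fun i : Fin (a.val + 1) => t (σ ⟨i.val, by omega⟩)) ++
        ((List.ofFn fun i : Fin (N - a.val) => t (σ ⟨a.val + 1 + i.val, by omega⟩)) ++ [y] ++
          (List.ofFn R).flatten)) =
      listSign edgeOrder (p ∘ j) (List.ofFn t ++ Q) * permSign σ fun i => p (j (t i)) := by
    intro a σ
    rw [List.append_assoc, ← hQ, ← List.append_assoc,
      ← ofFn_eq_append (by omega : a.val + 1 + (N - a.val) = N + 1) fun i => t (σ i),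
      listSign_append, listSign_append (List.ofFn t), listSign_ofFn_comp_perm isTournament_edgeOrder _ ht,
      crossSign_perm (show (List.ofFn fun i => t (σ i)).Perm (List.ofFn t) from
        σ.ofFn_comp_perm t) (List.Perm.refl Q)]
    simp only [Function.comp_apply]
    ac_rfl
  refine Eq.trans ?_ ((congrArg
    (fun z => (listSign edgeOrder (p ∘ j) (List.ofFn t ++ Q) • z) * X) key).trans (by simp))
  rw [Finset.smul_sum, Finset.sum_mul]
  refine Finset.sum_congr rfl fun a _ => ?_
  rw [Finset.smul_sum, Finset.sum_mul]
  refine Finset.sum_congr rfl fun σ _ => ?_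
  rw [hsign, ← smul_smul]
  simp only [List.map_append, List.map_ofFn, List.map_cons, List.map_nil]
  rfl

end SplitContraction

/-! ### The splittings of a vertex -/

section Splittings

variable {n m : ℕ}

/-- Contraction of the edge `0`, which goes from the vertex `0` to the vertex `1`, turns `f` into
`f'`. -/
def IsSplitting (f' : Fin m × Bool → Fin (n + 1)) (f : Fin (m + 1) × Bool → Fin (n + 2)) : Prop :=
  f (0, false) = 0 ∧ f (0, true) = 1 ∧ ∀ x, Fin.predAbove 0 (f (succHalfEdge x)) = f' x

/-- `Fin.predAbove 0` merges the vertices `0` and `1` and lowers the others by one: it is the vertex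
map of the contraction of an edge from `0` to `1`. -/
theorem predAbove_zero_eq {v : Fin (n + 2)} {w : Fin (n + 1)} :
    Fin.predAbove 0 v = w ↔ (v = 0 ∧ w = 0) ∨ v = w.succ := by
  refine Fin.cases ?_ (fun u => ?_) v
  · simp [eq_comm]
  · simp

theorem eq_zero_or_one_of_predAbove {v : Fin (n + 2)} (h : Fin.predAbove 0 v = 0) :
    v = 0 ∨ v = 1 := by
  rcases predAbove_zero_eq.1 h with h | h
  · exact Or.inl h.1
  · exact Or.inr (by rw [h, Fin.succ_zero_eq_one])

theorem isSplitting_splitMap (f : Fin m × Bool → Fin (n + 1)) (A : Set (Fin m × Bool)) :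
    IsSplitting f (splitMap f A) := by
  refine ⟨rfl, rfl, fun x => ?_⟩
  rw [splitMap_succHalfEdge, predAbove_zero_eq]
  split_ifs with h1 h2
  · simp [h1]
  · simp [h1]
  · simp

theorem IsSplitting.eq_splitMap {f' : Fin m × Bool → Fin (n + 1)}
    {f : Fin (m + 1) × Bool → Fin (n + 2)} (h : IsSplitting f' f) {A : Set (Fin m × Bool)}
    (hA : ∀ x, f' x = 0 → (x ∈ A ↔ f (succHalfEdge x) = 0)) : f = splitMap f' A := by
  funext x
  revert x
  refine forall_halfEdge (fun x => ?_) fun x => ?_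
  · rw [splitMap_zero]
    cases x
    · exact h.1
    · exact h.2.1
  · have h1 := h.2.2 x
    rw [splitMap_succHalfEdge]
    split_ifs with h2 h3
    · exact (hA x h2).1 h3
    · rw [h2] at h1
      exact (eq_zero_or_one_of_predAbove h1).resolve_left fun h4 => h3 ((hA x h2).2 h4)
    · exact (predAbove_zero_eq.1 h1).resolve_left fun h4 => h2 h4.2

end Splittings

/-! ### Cancellation among the splittings of a vertex -/

section FiberSum

variable {k W : Type*} [Field k] [AddCommGroup W] [Module k W] {𝒲 : ZMod 2 → Submodule k W}
  {ι : Type*} [Fintype ι] [DecidableEq ι] {n m : ℕ}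
  {L : LInfinityAlgebra k 𝒲} {B : LinearMap.BilinForm k W} {b : Module.Basis ι k W}
  {p : ι → ZMod 2}

/-- This allows sums over all subsets of half-edges, although graphs must be at least trivalent. -/
theorem graphNumber_eq_zero_of_valence (hd : L.d 0 = 0) {f : Fin m × Bool → Fin n} {v : Fin n}
    (hv : valence f v < 3) : graphNumber L B b p f = 0 := by
  refine Finset.sum_eq_zero fun j _ => ?_
  have h : vertexTensor L B b ((fiberList f v).map j) = 0 :=
    vertexTensor_eq_zero_of_length hd (by
      rw [List.length_map, (isFiberList_fiberList f).length_eq]; exact hv)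
  rw [labelTerm, Finset.prod_eq_zero (mem_univ v) h, zero_mul, smul_zero]

theorem sum_graphNumber_splitMap [CharZero k] (hB : IsInvariantInnerProduct L B)
    (hb : ∀ i, b i ∈ 𝒲 (p i)) (hd : L.d 0 = 0) {f : Fin m × Bool → Fin (n + 1)} {N : ℕ}
    {t : Fin (N + 1) → Fin m × Bool} (ht : Function.Injective t) {y : Fin m × Bool}
    (hy : ∀ i, t i ≠ y) (hf : ∀ x, f x = 0 ↔ (∃ i, t i = x) ∨ x = y) :
    ∑ S : Finset (Fin (N + 1)), graphNumber L B b p (splitMap f {x | ∃ i ∈ S, t i = x}) = 0 := by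
  have hR : ∀ v : Fin n, (fiberList f v.succ).Nodup ∧ ∀ x, x ∈ fiberList f v.succ ↔ f x = v.succ :=
    fun v => isFiberList_fiberList f v.succ
  -- The empty set is no term of the relation, whose inner operation has at least one argument. It
  -- leaves only the new half-edge at vertex `0`, so it contributes zero.
  have h0 : graphNumber L B b p (splitMap f {x | ∃ i ∈ (∅ : Finset (Fin (N + 1))), t i = x}) =
      0 := by
    refine graphNumber_eq_zero_of_valence hd (v := 0) ?_
    have := isFiberList_splitLists (f := f) (A := {x | ∃ i ∈ (∅ : Finset (Fin (N + 1))), t i = x})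
      (A₀ := []) (A₁ := fiberList f 0) List.nodup_nil (by simp) (isFiberList_fiberList f 0).1
      (fun x => by rw [(isFiberList_fiberList f 0).2]; simp) hR
    rw [← this.length_eq 0]
    simp [splitLists]
  rw [← sum_unshuffles_eq_sum_finset
    (fun S => graphNumber L B b p (splitMap f {x | ∃ i ∈ S, t i = x})) h0,
    ← sum_unshuffles_contraction hB hb ht y fun v => fiberList f v.succ]
  refine Finset.sum_congr rfl fun a _ => Finset.sum_congr rfl fun σ _ => ?_
  refine contraction_congr hB hb (isFiberList_fiberList _) (isFiberList_splitLists ?_ ?_ ?_ ?_ hR)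
  · refine List.nodup_ofFn.2 fun i i' h => ?_
    have := congrArg Fin.val (σ.injective (ht h))
    exact Fin.ext this
  · intro x
    rw [List.mem_ofFn, hf]
    constructor
    · rintro ⟨i, rfl⟩
      exact ⟨Or.inl ⟨_, rfl⟩, _, mem_firstImage.2 i.2, rfl⟩
    · rintro ⟨-, i, hi, rfl⟩
      obtain ⟨i, rfl⟩ := σ.surjective i
      exact ⟨⟨i, mem_firstImage.1 hi⟩, rfl⟩
  · rw [List.nodup_append]
    refine ⟨List.nodup_ofFn.2 fun i i' h => ?_, List.nodup_singleton _, ?_⟩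
    · have := congrArg Fin.val (σ.injective (ht h))
      exact Fin.ext (by simpa using this)
    · intro x hx x' hx'
      obtain ⟨i, rfl⟩ := List.mem_ofFn.1 hx
      rw [List.mem_singleton.1 hx']
      exact hy _
  · intro x
    rw [List.mem_append, List.mem_ofFn, List.mem_singleton, hf]
    constructor
    · rintro (⟨i, rfl⟩ | rfl)
      · refine ⟨Or.inl ⟨_, rfl⟩, ?_⟩
        rintro ⟨i', hi', h⟩
        rw [ht h, mem_firstImage] at hi'
        simp at hi'
        omega
      · exact ⟨Or.inr rfl, fun ⟨i, _, h⟩ => hy i h⟩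
    · rintro ⟨⟨i, rfl⟩ | rfl, h⟩
      · obtain ⟨i, rfl⟩ := σ.surjective i
        left
        have hi : ¬ i.val < a.val + 1 := fun hi => h ⟨_, mem_firstImage.2 hi, rfl⟩
        refine ⟨⟨i.val - (a.val + 1), by omega⟩, ?_⟩
        congr 2
        exact Fin.ext (by simp; omega)
      · exact Or.inr rfl

theorem relabel_apply (g : Relabeling n m) (Γ : OrientedGraph n m) (x : Fin m × Bool) :
    (relabel g Γ).1 (halfEdgePerm g.2.1 g.2.2 x) = g.1 (Γ.1 x) :=
  congrArg (fun z => g.1 (Γ.1 z)) (Equiv.symm_apply_apply _ x)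

-- A splitting with `y` at the head is determined by the set of the other half-edges that stay at
-- the tail.
open Classical in
theorem sum_graphNumber_isSplitting_head [CharZero k] (hB : IsInvariantInnerProduct L B)
    (hb : ∀ i, b i ∈ 𝒲 (p i)) (hd : L.d 0 = 0) {f : Fin m × Bool → Fin (n + 1)} {N : ℕ}
    {t : Fin (N + 1) → Fin m × Bool} (ht : Function.Injective t) {y : Fin m × Bool}
    (hy : ∀ i, t i ≠ y) (hf : ∀ x, f x = 0 ↔ (∃ i, t i = x) ∨ x = y) :
    ∑ Γ : OrientedGraph (n + 2) (m + 1) with IsSplitting f Γ.1 ∧ Γ.1 (succHalfEdge y) = 1,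
      graphNumber L B b p Γ.1 = 0 := by
  rw [← sum_graphNumber_splitMap hB hb hd ht hy hf]
  have hsplit : ∀ Γ : OrientedGraph (n + 2) (m + 1), IsSplitting f Γ.1 →
      Γ.1 (succHalfEdge y) = 1 → Γ.1 = splitMap f
        {x | ∃ i ∈ univ.filter (fun i => Γ.1 (succHalfEdge (t i)) = 0), t i = x} := by
    intro Γ h h1
    refine h.eq_splitMap fun x hx => ?_
    simp only [mem_filter, mem_univ, true_and, Set.mem_ofPred_eq]
    constructor
    · rintro ⟨i, hi, rfl⟩
      exact hi
    · intro h0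
      rcases (hf x).1 hx with ⟨i, rfl⟩ | rfl
      · exact ⟨i, h0, rfl⟩
      · rw [h0] at h1
        simp at h1
  refine Finset.sum_of_injOn
    (fun Γ => univ.filter (fun i => Γ.1 (succHalfEdge (t i)) = 0)) ?_ (fun _ _ => mem_univ _) ?_ ?_
  · intro Γ hΓ Γ' hΓ' h
    simp only [coe_filter, mem_univ, true_and, Set.mem_ofPred_eq] at hΓ hΓ'
    apply Subtype.ext
    rw [hsplit Γ hΓ.1 hΓ.2, hsplit Γ' hΓ'.1 hΓ'.2]
    simp only at h
    rw [h]
  -- A subset that comes from no admissible graph produces a vertex of valence below three, hence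
  -- the number zero.
  · intro S _ hS
    by_contra hne
    apply hS
    have hval : ∀ v, 3 ≤ valence (splitMap f {x | ∃ i ∈ S, t i = x}) v := fun v => by
      by_contra hv
      exact hne (graphNumber_eq_zero_of_valence hd (not_le.1 hv))
    refine ⟨⟨_, hval⟩, ?_, ?_⟩
    · simp only [coe_filter, mem_univ, true_and, Set.mem_ofPred_eq]
      refine ⟨isSplitting_splitMap _ _, ?_⟩
      rw [splitMap_succHalfEdge, if_pos ((hf y).2 (Or.inr rfl)), if_neg]
      rintro ⟨i, -, h⟩
      exact hy i h
    · ext i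
      simp only [mem_filter, mem_univ, true_and]
      rw [splitMap_succHalfEdge, if_pos ((hf _).2 (Or.inl ⟨i, rfl⟩))]
      have : t i ∈ {x | ∃ i ∈ S, t i = x} ↔ i ∈ S :=
        ⟨fun ⟨i', hi', h⟩ => ht h ▸ hi', fun h => ⟨i, h, rfl⟩⟩
      rw [this]
      split_ifs with h <;> simp [h]
  · intro Γ hΓ
    simp only [mem_filter, mem_univ, true_and] at hΓ
    conv_lhs => rw [hsplit Γ hΓ.1 hΓ.2]

/-- The relabeling that exchanges the ends of the edge `0` between the vertices `0` and `1`. -/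
def flipFirstEdge : Relabeling (n + 2) (m + 1) :=
  (Equiv.swap 0 1, 1, fun e => decide (e = 0))

/-- The transposition of the two vertices and the one reversed arrow cancel. -/
theorem orientationSign_flipFirstEdge :
    orientationSign (flipFirstEdge : Relabeling (n + 2) (m + 1)) = 1 := by
  rw [orientationSign, Fin.prod_univ_succ]
  simp [flipFirstEdge, Fin.succ_ne_zero]

theorem relabel_flipFirstEdge_zero (Γ : OrientedGraph (n + 2) (m + 1)) (x : Bool) :
    (relabel flipFirstEdge Γ).1 (0, x) = Equiv.swap 0 1 (Γ.1 (0, !x)) := by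
  have := relabel_apply flipFirstEdge Γ (0, !x)
  rw [halfEdgePerm_apply] at this
  simpa [flipFirstEdge] using this

theorem relabel_flipFirstEdge_succHalfEdge (Γ : OrientedGraph (n + 2) (m + 1))
    (x : Fin m × Bool) :
    (relabel flipFirstEdge Γ).1 (succHalfEdge x) = Equiv.swap 0 1 (Γ.1 (succHalfEdge x)) := by
  have := relabel_apply flipFirstEdge Γ (succHalfEdge x)
  rw [succHalfEdge, halfEdgePerm_apply] at this
  simpa [flipFirstEdge, succHalfEdge, Fin.succ_ne_zero] using this

theorem predAbove_zero_swap (v : Fin (n + 2)) :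
    Fin.predAbove 0 (Equiv.swap 0 1 v) = Fin.predAbove (0 : Fin (n + 1)) v := by
  have h0' : Fin.predAbove (0 : Fin (n + 1)) 0 = 0 := predAbove_zero_eq.2 (Or.inl ⟨rfl, rfl⟩)
  have h1' : Fin.predAbove (0 : Fin (n + 1)) 1 = 0 :=
    predAbove_zero_eq.2 (Or.inr Fin.succ_zero_eq_one.symm)
  by_cases h0 : v = 0
  · subst h0
    rw [Equiv.swap_apply_left, h0', h1']
  · by_cases h1 : v = 1
    · subst h1
      rw [Equiv.swap_apply_right, h0', h1']
    · rw [Equiv.swap_apply_of_ne_of_ne h0 h1]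

theorem isSplitting_relabel_flipFirstEdge {f : Fin m × Bool → Fin (n + 1)}
    {Γ : OrientedGraph (n + 2) (m + 1)} (h : IsSplitting f Γ.1) :
    IsSplitting f (relabel flipFirstEdge Γ).1 := by
  refine ⟨?_, ?_, fun x => ?_⟩
  · rw [relabel_flipFirstEdge_zero, Bool.not_false, h.2.1, Equiv.swap_apply_right]
  · rw [relabel_flipFirstEdge_zero, Bool.not_true, h.1, Equiv.swap_apply_left]
  · rw [relabel_flipFirstEdge_succHalfEdge, predAbove_zero_swap, h.2.2]

theorem relabel_flipFirstEdge_involutive :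
    Function.Involutive (relabel (flipFirstEdge : Relabeling (n + 2) (m + 1))) := by
  intro Γ
  apply Subtype.ext
  funext x
  revert x
  refine forall_halfEdge (fun x => ?_) fun x => ?_
  · rw [relabel_flipFirstEdge_zero, relabel_flipFirstEdge_zero, Equiv.swap_apply_self,
      Bool.not_not]
  · rw [relabel_flipFirstEdge_succHalfEdge, relabel_flipFirstEdge_succHalfEdge,
      Equiv.swap_apply_self]

open Classical in
/-- The numbers of the graphs which become a given graph by contraction of an edge cancel. -/
theorem sum_graphNumber_isSplitting [CharZero k] (hB : IsInvariantInnerProduct L B)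
    (hb : ∀ i, b i ∈ 𝒲 (p i)) (hd : L.d 0 = 0) (Γ' : OrientedGraph (n + 1) m) :
    ∑ Γ : OrientedGraph (n + 2) (m + 1) with IsSplitting Γ'.1 Γ.1,
      graphNumber L B b p Γ.1 = 0 := by
  have hfl := isFiberList_fiberList Γ'.1 0
  have hlen := (isFiberList_fiberList Γ'.1).length_eq 0
  obtain ⟨N, hN⟩ : ∃ N, valence Γ'.1 0 = N + 2 :=
    ⟨valence Γ'.1 0 - 2, by have := Γ'.2 0; omega⟩
  obtain ⟨u, hu⟩ := exists_eq_ofFn (hlen.trans hN)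
  rw [hu] at hfl
  have hinj : Function.Injective u := List.nodup_ofFn.1 hfl.1
  set t : Fin (N + 1) → Fin m × Bool := fun i => u i.castSucc with ht
  set y := u (Fin.last _) with hy
  have htinj : Function.Injective t := fun i i' h => Fin.castSucc_injective _ (hinj h)
  have hty : ∀ i, t i ≠ y := fun i h => (Fin.castSucc_lt_last i).ne (hinj h)
  have hf : ∀ x, Γ'.1 x = 0 ↔ (∃ i, t i = x) ∨ x = y := by
    intro x
    rw [← hfl.2, List.mem_ofFn]
    constructor
    · rintro ⟨i, rfl⟩
      refine Fin.lastCases (Or.inr rfl) (fun i => Or.inl ⟨i, rfl⟩) i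
    · rintro (⟨i, rfl⟩ | rfl)
      · exact ⟨_, rfl⟩
      · exact ⟨_, rfl⟩
  have h1 := sum_graphNumber_isSplitting_head hB hb hd htinj hty hf
  have hy0 : Γ'.1 y = 0 := (hf y).2 (Or.inr rfl)
  -- The half-edge `y` lies at the head or at the tail of the new edge. The flip exchanges the two
  -- cases without a sign, so the second sum equals the first, which is `h1`.
  rw [← Finset.sum_filter_add_sum_filter_not _ fun Γ => Γ.1 (succHalfEdge y) = 1,
    Finset.filter_filter, Finset.filter_filter, h1, zero_add, ← h1]
  refine Finset.sum_nbij' (relabel flipFirstEdge) (relabel flipFirstEdge) ?_ ?_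
    (fun Γ _ => relabel_flipFirstEdge_involutive Γ)
    (fun Γ _ => relabel_flipFirstEdge_involutive Γ) ?_
  · intro Γ hΓ
    simp only [mem_filter, mem_univ, true_and] at hΓ ⊢
    refine ⟨isSplitting_relabel_flipFirstEdge hΓ.1, ?_⟩
    have := (eq_zero_or_one_of_predAbove ((hΓ.1.2.2 y).trans hy0)).resolve_right hΓ.2
    rw [relabel_flipFirstEdge_succHalfEdge, this, Equiv.swap_apply_left]
  · intro Γ hΓ
    simp only [mem_filter, mem_univ, true_and] at hΓ ⊢
    refine ⟨isSplitting_relabel_flipFirstEdge hΓ.1, ?_⟩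
    rw [relabel_flipFirstEdge_succHalfEdge, hΓ.2, Equiv.swap_apply_right]
    simp
  · intro Γ _
    rw [graphNumber_relabel hB hb, orientationSign_flipFirstEdge, one_smul]

/-! ### The boundary -/

open Classical in
theorem sum_boundaryTerm_relabel [CharZero k] (hB : IsInvariantInnerProduct L B)
    (hb : ∀ i, b i ∈ 𝒲 (p i)) {P : OrientedGraph (n + 1) (m + 1) → Prop}
    (hP : ∀ g Γ, P (relabel g Γ) ↔ P Γ) (σ : Equiv.Perm (Fin (n + 1)))
    (π : Equiv.Perm (Fin (m + 1))) (u w : Fin (n + 1)) (e : Fin (m + 1)) :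
    ∑ Γ with P Γ ∧ Γ.1 (e, false) = u ∧ Γ.1 (e, true) = w,
        graphNumber L B b p Γ.1 • boundaryTerm k Γ e =
      ∑ Γ with P Γ ∧ Γ.1 (π e, false) = σ u ∧ Γ.1 (π e, true) = σ w,
        graphNumber L B b p Γ.1 • boundaryTerm k Γ (π e) := by
  set g : Relabeling (n + 1) (m + 1) := (σ, π, fun _ => false) with hg
  have hat : ∀ (Γ : OrientedGraph (n + 1) (m + 1)) x,
      (relabel g Γ).1 (π e, x) = σ (Γ.1 (e, x)) := fun Γ x => by
    have := relabel_apply g Γ (e, x)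
    rw [halfEdgePerm_apply] at this
    simpa [hg] using this
  refine Finset.sum_bijective (relabel g) (relabel_bijective g) (fun Γ => ?_) fun Γ _ => ?_
  · simp only [mem_filter, mem_univ, true_and, hat, hP, EmbeddingLike.apply_eq_iff_eq]
  · rw [graphNumber_relabel hB hb, show π e = g.2.1 e from rfl, boundaryTerm_relabel,
      smul_smul_units]

theorem isSplitting_contract_first (Γ : OrientedGraph (n + 2) (m + 1)) (h0 : Γ.1 (0, false) = 0)
    (h1 : Γ.1 (0, true) = 1) (h : Γ.1 (0, false) ≠ Γ.1 (0, true)) :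
    IsSplitting (contract Γ 0 h).1 Γ.1 := by
  refine ⟨h0, h1, fun x => ?_⟩
  -- The ends are generalised to variables, since `mergeMap` carries a proof about them.
  have key : ∀ (u w : Fin (n + 2)) (h : u ≠ w), u = 0 → w = 1 → ∀ v,
      Fin.predAbove 0 v = mergeMap u w h v := by
    rintro u w h rfl rfl v
    apply Fin.succAbove_right_injective (p := 1)
    rw [succAbove_mergeMap]
    refine Fin.cases ?_ (fun v => ?_) v
    · simp
    · rw [Fin.predAbove_zero_succ]
      refine Fin.cases ?_ (fun v => ?_) v
      · simp
      · have : v.succ.succ ≠ (1 : Fin (n + 2)) := by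
          rw [← Fin.succ_zero_eq_one, Ne, Fin.succ_inj]
          exact Fin.succ_ne_zero v
        rw [if_neg this, ← Fin.succ_zero_eq_one, Fin.succ_succAbove_succ, Fin.succAbove_zero]
  exact key _ _ h h0 h1 _

theorem IsSplitting.unique {Γ : OrientedGraph (n + 2) (m + 1)} {Γ₁ Γ₂ : OrientedGraph (n + 1) m}
    (h₁ : IsSplitting Γ₁.1 Γ.1) (h₂ : IsSplitting Γ₂.1 Γ.1) : Γ₁ = Γ₂ :=
  Subtype.ext (funext fun x => (h₁.2.2 x).symm.trans (h₂.2.2 x))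

/-- The head is vertex `1` and the last vertex is `n + 1`, whence the exponent `n`. The sign is
common to all splittings and does not affect their cancellation. -/
theorem boundaryTerm_of_isSplitting {Γ : OrientedGraph (n + 2) (m + 1)}
    {Γ' : OrientedGraph (n + 1) m} (h : IsSplitting Γ'.1 Γ.1) :
    boundaryTerm k Γ 0 = (-1 : ℤˣ) ^ n • graphClass k Γ' := by
  have hne : Γ.1 (0, false) ≠ Γ.1 (0, true) := by rw [h.1, h.2.1]; simp
  rw [boundaryTerm, dif_pos hne, (isSplitting_contract_first Γ h.1 h.2.1 hne).unique h, h.2.1]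
  simp

open Classical in
theorem sum_boundaryTerm_first [CharZero k] (hB : IsInvariantInnerProduct L B)
    (hb : ∀ i, b i ∈ 𝒲 (p i)) (hd : L.d 0 = 0) {P : OrientedGraph (n + 2) (m + 1) → Prop}
    {P' : OrientedGraph (n + 1) m → Prop}
    (hPP' : ∀ Γ Γ', IsSplitting Γ'.1 Γ.1 → (P Γ ↔ P' Γ')) :
    ∑ Γ with P Γ ∧ Γ.1 (0, false) = 0 ∧ Γ.1 (0, true) = 1,
      graphNumber L B b p Γ.1 • boundaryTerm k Γ 0 = 0 := by
  have h1 : ∀ Γ ∈ univ.filter (fun Γ : OrientedGraph (n + 2) (m + 1) =>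
      P Γ ∧ Γ.1 (0, false) = 0 ∧ Γ.1 (0, true) = 1),
      graphNumber L B b p Γ.1 • boundaryTerm k Γ 0 =
        ∑ Γ' : OrientedGraph (n + 1) m, if IsSplitting Γ'.1 Γ.1 then
          graphNumber L B b p Γ.1 • ((-1 : ℤˣ) ^ n • graphClass k Γ') else 0 := by
    intro Γ hΓ
    simp only [mem_filter, mem_univ, true_and] at hΓ
    have hne : Γ.1 (0, false) ≠ Γ.1 (0, true) := by rw [hΓ.2.1, hΓ.2.2]; simp
    have hs := isSplitting_contract_first Γ hΓ.2.1 hΓ.2.2 hne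
    rw [Finset.sum_eq_single (contract Γ 0 hne), if_pos hs, boundaryTerm_of_isSplitting hs]
    · exact fun Γ' _ hne' => if_neg fun h => hne' (h.unique hs)
    · exact fun h => absurd (mem_univ _) h
  -- The sum is regrouped by the contracted graph `Γ'`, which decides whether its splittings have
  -- the property `P`; so all of them occur or none.
  rw [Finset.sum_congr rfl h1, Finset.sum_comm]
  refine Finset.sum_eq_zero fun Γ' _ => ?_
  rw [← Finset.sum_filter, Finset.filter_filter, ← Finset.sum_smul]
  by_cases h' : P' Γ'
  · have : univ.filter (fun Γ : OrientedGraph (n + 2) (m + 1) =>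
        (P Γ ∧ Γ.1 (0, false) = 0 ∧ Γ.1 (0, true) = 1) ∧ IsSplitting Γ'.1 Γ.1) =
        univ.filter fun Γ => IsSplitting Γ'.1 Γ.1 := by
      ext Γ
      simp only [mem_filter, mem_univ, true_and, and_iff_right_iff_imp]
      exact fun h => ⟨(hPP' Γ Γ' h).2 h', h.1, h.2.1⟩
    rw [this, sum_graphNumber_isSplitting hB hb hd, zero_smul]
  · rw [Finset.sum_eq_zero, zero_smul]
    intro Γ hΓ
    simp only [mem_filter, mem_univ, true_and] at hΓ
    exact absurd ((hPP' Γ Γ' hΓ.2).1 hΓ.1.1) h'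

theorem exists_perm_to_zero_one {u w : Fin (n + 2)} (h : u ≠ w) :
    ∃ σ : Equiv.Perm (Fin (n + 2)), σ u = 0 ∧ σ w = 1 := by
  have h1 : Equiv.swap u 0 w ≠ 0 := fun h' => h (by
    rw [Equiv.swap_apply_eq_iff, Equiv.swap_apply_right] at h'
    exact h'.symm)
  refine ⟨Equiv.swap (Equiv.swap u 0 w) 1 * Equiv.swap u 0, ?_, ?_⟩
  · rw [Equiv.Perm.mul_apply, Equiv.swap_apply_left,
      Equiv.swap_apply_of_ne_of_ne h1.symm (by simp)]
  · rw [Equiv.Perm.mul_apply, Equiv.swap_apply_left]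

open Classical in
theorem sum_boundaryTerm_of_ne [CharZero k] (hB : IsInvariantInnerProduct L B)
    (hb : ∀ i, b i ∈ 𝒲 (p i)) (hd : L.d 0 = 0) {P : OrientedGraph (n + 2) (m + 1) → Prop}
    (hP : ∀ g Γ, P (relabel g Γ) ↔ P Γ) {P' : OrientedGraph (n + 1) m → Prop}
    (hPP' : ∀ Γ Γ', IsSplitting Γ'.1 Γ.1 → (P Γ ↔ P' Γ')) {u w : Fin (n + 2)} (h : u ≠ w)
    (e : Fin (m + 1)) :
    ∑ Γ with P Γ ∧ Γ.1 (e, false) = u ∧ Γ.1 (e, true) = w,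
      graphNumber L B b p Γ.1 • boundaryTerm k Γ e = 0 := by
  obtain ⟨σ, h0, h1⟩ := exists_perm_to_zero_one h
  rw [sum_boundaryTerm_relabel hB hb hP σ (Equiv.swap e 0), h0, h1, Equiv.swap_apply_left,
    sum_boundaryTerm_first hB hb hd hPP']

-- The sum vanishes already for a fixed name `e` of the contracted edge and fixed end points `u`,
-- `w`.
open Classical in
theorem sum_sum_boundaryTerm [CharZero k] (hB : IsInvariantInnerProduct L B)
    (hb : ∀ i, b i ∈ 𝒲 (p i)) (hd : L.d 0 = 0) {P : OrientedGraph (n + 1) (m + 1) → Prop}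
    (hP : ∀ g Γ, P (relabel g Γ) ↔ P Γ) {P' : OrientedGraph n m → Prop}
    (hPP' : ∀ Γ e h, P Γ ↔ P' (contract Γ e h)) :
    ∑ Γ with P Γ, graphNumber L B b p Γ.1 • ∑ e, boundaryTerm k Γ e = 0 := by
  have hloop : ∀ (Γ : OrientedGraph (n + 1) (m + 1)) e, Γ.1 (e, false) = Γ.1 (e, true) →
      boundaryTerm k Γ e = 0 := fun Γ e h => by
    rw [boundaryTerm, dif_neg (not_not.2 h)]
  simp only [Finset.smul_sum]
  rw [Finset.sum_comm]
  refine Finset.sum_eq_zero fun e _ => ?_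
  rw [← Finset.sum_fiberwise _ fun Γ => Γ.1 (e, false)]
  refine Finset.sum_eq_zero fun u _ => ?_
  rw [← Finset.sum_fiberwise _ fun Γ => Γ.1 (e, true)]
  refine Finset.sum_eq_zero fun w _ => ?_
  rw [Finset.filter_filter, Finset.filter_filter]
  by_cases h : u = w
  · refine Finset.sum_eq_zero fun Γ hΓ => ?_
    simp only [mem_filter, mem_univ, true_and] at hΓ
    rw [hloop Γ e (hΓ.2.1.trans (h.trans hΓ.2.2.symm)), smul_zero]
  -- With a single vertex every edge is a loop.
  · obtain _ | n := n
    · exact absurd (Fin.ext (by omega)) h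
    · refine sum_boundaryTerm_of_ne hB hb hd hP (P' := P') (fun Γ Γ' hs => ?_) h e
      have hne : Γ.1 (0, false) ≠ Γ.1 (0, true) := by rw [hs.1, hs.2.1]; simp
      rw [hPP' Γ 0 hne, (isSplitting_contract_first Γ hs.1 hs.2.1 hne).unique hs]

theorem boundary_graphChain [CharZero k] (hB : IsInvariantInnerProduct L B)
    (hb : ∀ i, b i ∈ 𝒲 (p i)) (hd : L.d 0 = 0) {P : OrientedGraph (n + 1) (m + 1) → Prop}
    (hP : ∀ g Γ, P (relabel g Γ) ↔ P Γ) {P' : OrientedGraph n m → Prop}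
    (hPP' : ∀ Γ e h, P Γ ↔ P' (contract Γ e h)) {R : Finset (OrientedGraph (n + 1) (m + 1))}
    (hR : IsRepresentatives P R) (o : ∀ Γ : OrientedGraph (n + 1) (m + 1), HalfEdgeOrder Γ) :
    boundary k n m (graphChain L B b p R o) = 0 := by
  classical
  have hcard : (Fintype.card (Relabeling (n + 1) (m + 1)) : k) ≠ 0 :=
    Nat.cast_ne_zero.2 Fintype.card_ne_zero
  refine (smul_eq_zero.1 ?_).resolve_left hcard
  rw [← map_smul, card_smul_graphChain hB hb hP o hR, map_sum]
  simp only [map_smul, boundary_graphClass]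
  convert sum_sum_boundaryTerm (k := k) hB hb hd hP hPP'

end FiberSum

/-! ### Connected graphs -/

section Connected

variable {n m : ℕ}

/-- Predicates constant along edges can be pulled back along maps of vertices, which is easier than
transporting walks. -/
theorem isConnected_iff (Γ : OrientedGraph n m) : IsConnected Γ ↔ Nonempty (Fin n) ∧
    ∀ f : Fin n → Prop, (∀ e, f (Γ.1 (e, false)) ↔ f (Γ.1 (e, true))) → ∀ u v, f u → f v := by
  rw [IsConnected, SimpleGraph.connected_iff, and_comm]
  refine and_congr_right fun _ => ⟨fun h f hf u v hu => ?_, fun h u v => ?_⟩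
  · obtain ⟨w⟩ := h u v
    induction w with
    | nil => exact hu
    | cons hadj _ ih =>
      apply ih
      rw [SimpleGraph.fromRel_adj] at hadj
      obtain ⟨-, ⟨e, rfl, rfl⟩ | ⟨e, rfl, rfl⟩⟩ := hadj
      · exact (hf e).1 hu
      · exact (hf e).2 hu
  · refine h (fun v => (SimpleGraph.fromRel fun u v =>
      ∃ e, Γ.1 (e, false) = u ∧ Γ.1 (e, true) = v).Reachable u v) (fun e => ?_) u v
      (SimpleGraph.Reachable.refl u)
    by_cases he : Γ.1 (e, false) = Γ.1 (e, true)
    · rw [he]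
    · have hadj : (SimpleGraph.fromRel fun u v =>
          ∃ e, Γ.1 (e, false) = u ∧ Γ.1 (e, true) = v).Adj (Γ.1 (e, false)) (Γ.1 (e, true)) :=
        (SimpleGraph.fromRel_adj _ _ _).2 ⟨he, Or.inl ⟨e, rfl, rfl⟩⟩
      exact ⟨fun h => h.trans hadj.reachable, fun h => h.trans hadj.symm.reachable⟩

theorem IsConnected.relabel {Γ : OrientedGraph n m} (h : IsConnected Γ) (g : Relabeling n m) :
    IsConnected (relabel g Γ) := by
  rw [isConnected_iff] at h ⊢
  refine ⟨h.1, fun f hf u v hu => ?_⟩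
  have := h.2 (fun x => f (g.1 x)) (fun e => ?_) (g.1.symm u) (g.1.symm v) (by simpa using hu)
  · simpa using this
  · rw [← relabel_apply, ← relabel_apply, halfEdgePerm_apply, halfEdgePerm_apply]
    have := hf (g.2.1 e)
    by_cases hρ : g.2.2 e = true
    · simpa [hρ] using this.symm
    · simpa [hρ] using this

theorem isConnected_relabel (g : Relabeling n m) (Γ : OrientedGraph n m) :
    IsConnected (relabel g Γ) ↔ IsConnected Γ := by
  refine ⟨fun h => ?_, fun h => h.relabel g⟩
  obtain ⟨g', hg'⟩ := exists_relabel_inv g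
  exact hg' Γ ▸ h.relabel g'

/-- A predicate constant along `e` is the same as a predicate on the merged vertices; `mergeMap` and
`succAbove` at the head of `e` translate between the two. -/
theorem isConnected_contract (Γ : OrientedGraph (n + 1) (m + 1)) (e : Fin (m + 1))
    (h : Γ.1 (e, false) ≠ Γ.1 (e, true)) : IsConnected Γ ↔ IsConnected (contract Γ e h) := by
  rw [isConnected_iff, isConnected_iff]
  have hm := succAbove_mergeMap (Γ.1 (e, false)) (Γ.1 (e, true)) h
  have hsame : mergeMap _ _ h (Γ.1 (e, false)) = mergeMap _ _ h (Γ.1 (e, true)) := by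
    apply Fin.succAbove_right_injective (p := Γ.1 (e, true))
    rw [hm, hm]
    simp
  have hsurj : ∀ y, mergeMap _ _ h ((Γ.1 (e, true)).succAbove y) = y := fun y => by
    apply Fin.succAbove_right_injective (p := Γ.1 (e, true))
    rw [hm, if_neg (Fin.succAbove_ne _ _)]
  constructor
  · rintro ⟨-, hc⟩
    refine ⟨⟨mergeMap _ _ h (Γ.1 (e, false))⟩, fun f hf u v hu => ?_⟩
    have := hc (fun x => f (mergeMap _ _ h x)) (fun e' => ?_) ((Γ.1 (e, true)).succAbove u)
      ((Γ.1 (e, true)).succAbove v) (by rw [hsurj]; exact hu)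
    · rwa [hsurj] at this
    · rcases Fin.eq_self_or_eq_succAbove e e' with rfl | ⟨e', rfl⟩
      · rw [hsame]
      · exact hf e'
  · rintro ⟨-, hc⟩
    refine ⟨⟨0⟩, fun f hf u v hu => ?_⟩
    have key : ∀ x, f ((Γ.1 (e, true)).succAbove (mergeMap _ _ h x)) ↔ f x := fun x => by
      rw [hm]
      split_ifs with hx
      · rw [hx]
        exact hf e
      · rfl
    rw [← key] at hu ⊢
    refine hc (fun y => f ((Γ.1 (e, true)).succAbove y)) (fun e' => ?_) _ _ hu
    have := hf (e.succAbove e')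
    rw [← key, ← key (Γ.1 (e.succAbove e', true))] at this
    exact this

end Connected

end GraphCycle

/-! ### The main theorem -/

theorem mainTheorem1 {k W : Type*} [Field k] [CharZero k] [AddCommGroup W] [Module k W]
    (𝒲 : ZMod 2 → Submodule k W) (h𝒲 : DirectSum.IsInternal 𝒲)
    (L : GraphCycle.LInfinityAlgebra k 𝒲) (hd : L.d 0 = 0)
    (B : LinearMap.BilinForm k W) (hB : GraphCycle.IsInvariantInnerProduct L B)
    {ι : Type*} [Fintype ι] [DecidableEq ι] (b : Module.Basis ι k W) (p : ι → ZMod 2)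
    (hb : ∀ i, b i ∈ 𝒲 (p i)) :
    (∀ (n m : ℕ) (Γ : GraphCycle.OrientedGraph n m) (g : GraphCycle.Relabeling n m)
      (o : GraphCycle.HalfEdgeOrder Γ) (o' : GraphCycle.HalfEdgeOrder (GraphCycle.relabel g Γ)),
      GraphCycle.partitionNumber L B b p (GraphCycle.relabel g Γ) o' =
        GraphCycle.orientationSign g • GraphCycle.partitionNumber L B b p Γ o) ∧
    (∀ (n m : ℕ) (P : GraphCycle.OrientedGraph n m → Prop)
      (R R' : Finset (GraphCycle.OrientedGraph n m))
      (o o' : ∀ Γ : GraphCycle.OrientedGraph n m, GraphCycle.HalfEdgeOrder Γ),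
      GraphCycle.IsRepresentatives P R → GraphCycle.IsRepresentatives P R' →
      GraphCycle.graphChain L B b p R o = GraphCycle.graphChain L B b p R' o') ∧
    (∀ (n m : ℕ) (R : Finset (GraphCycle.OrientedGraph (n + 1) (m + 1)))
      (o : ∀ Γ : GraphCycle.OrientedGraph (n + 1) (m + 1), GraphCycle.HalfEdgeOrder Γ),
      GraphCycle.IsRepresentatives (fun _ => True) R →
      GraphCycle.boundary k n m (GraphCycle.graphChain L B b p R o) = 0) ∧
    (∀ (n m : ℕ) (R : Finset (GraphCycle.OrientedGraph (n + 1) (m + 1)))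
      (o : ∀ Γ : GraphCycle.OrientedGraph (n + 1) (m + 1), GraphCycle.HalfEdgeOrder Γ),
      GraphCycle.IsRepresentatives GraphCycle.IsConnected R →
      GraphCycle.boundary k n m (GraphCycle.graphChain L B b p R o) = 0) := by

  refine ⟨fun n m Γ g o o' => GraphCycle.partitionNumber_relabel hB hb Γ g o o',
    fun n m P R R' o o' hR hR' =>
      GraphCycle.graphChain_eq_of_isRepresentatives hB hb o o' hR hR',
    fun n m R o hR => ?_, fun n m R o hR => ?_⟩
  · exact GraphCycle.boundary_graphChain hB hb hd (P' := fun _ => True)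
      (fun _ _ => Iff.rfl) (fun _ _ _ => Iff.rfl) hR o
  · exact GraphCycle.boundary_graphChain hB hb hd GraphCycle.isConnected_relabel
      GraphCycle.isConnected_contract hR o
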